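/- For $n\in\mathbf N$ set $\gamma=\gamma_n:=\tfrac12\bigl(\log n-5\log\log n-\log(2\pi^4)\bigr)$, and for $z,w\in\mathbf C$ define $$K_n(z,w):=\sum_{l=0}^{n-1}\frac{(nz\overline w)^l}{l!},\qquad \operatorname{erfc}(x):=\frac{2}{\sqrt\pi}\int_x^\infty e^{-s^2}\,ds,$$ $$S_n(z,w):=\frac{\mathrm i\,n\,e^{-n(z-\overline w)^2/2}}{\sqrt{2\pi}}\,\sqrt n\,(\overline w-z)\,\sqrt{\operatorname{erfc}(\sqrt{2n}\,|\Im z|)\operatorname{erfc}(\sqrt{2n}\,|\Im w|)}\;e^{-nz\overline w}K_n(z,w),$$ $$K_n^{\mathbf C,\mathbf C}(z,w):=\begin{pmatrix}S_n(z,w)&-\mathrm i\,S_n(z,\overline w)\\-\mathrm i\,S_n(\overline z,w)&S_n(w,z)\end{pmatrix}.$$ The kernel is considered on the upper half-plane $\mathbf H=\{z\in\mathbf C:\Im z\ge0\}$ with Lebesgue measure $d^2z$; for a $2\times2$ matrix kernel $K$ write $$\operatorname{Tr}K:=\int_{\mathbf H}\operatorname{tr}K(z,z)\,d^2z,\qquad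 \|K\|_2^2:=\int_{\mathbf H}\int_{\mathbf H}\sum_{i,j=1}^2|K(z,w)_{ij}|^2\,d^2w\,d^2z,$$ and let $\sqrt gK\sqrt g$ denote the kernel $\sqrt{g(z)}\,K(z,w)\,\sqrt{g(w)}$. For $t\in\mathbf R$ let $$A(t):=\Bigl\{z\in\mathbf C:\ \Re z\ge1+\sqrt{\tfrac{\gamma}{4n}}+\tfrac{t}{\sqrt{4\gamma n}}\Bigr\}.$$ **Proposition.** There is an absolute constant $C>0$ such that the following holds for every $n$ with $\gamma_n>0$, every real $t$ with $|t|\le\sqrt{\log n}/10$, and every measurable $g\colon\mathbf C\to[0,1]$ with $\operatorname{supp}g\subset A(t)$ and $g(z)=g(\overline z)$ for all $z$. The function $z\mapsto g(z)\operatorname{tr}K_n^{\mathbf C,\mathbf C}(z,z)$ is integrable on $\mathbf H$, $$\Bigl|\operatorname{Tr}\sqrt g\,K_n^{\mathbf C,\mathbf C}\sqrt g-2\int_t^\infty\int_0^\infty g(z)\,\frac{e^{-x-y^2}}{\sqrt\pi}\,dy\,dx\Bigr|\le C\,e^{-t}\,\frac{(\log\log n)^2+|t|^2}{\log n},$$ where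 in the integral $z=1+\sqrt{\frac{\gamma}{4n}}+\frac{x}{\sqrt{4\gamma n}}+\frac{\mathrm i y}{(\gamma n)^{1/4}}$, and $$\bigl\|\sqrt g\,K_n^{\mathbf C,\mathbf C}\sqrt g\bigr\|_2\le C\,e^{-\sqrt{\log n}/32}.$$ -/

import Mathlib

open MeasureTheory
open scoped ComplexConjugate

noncomputable section

namespace Ginibre

/-- The complementary error function `erfc x = (2 / √π) ∫_x^∞ exp (-s ^ 2) ds`. -/
def erfc (x : ℝ) : ℝ := 2 / √Real.pi * ∫ s in Set.Ioi x, Real.exp (-s ^ 2)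

/-- The scaling factor `γ_n = (log n - 5 log log n - log (2 π ^ 4)) / 2`. -/
def scale (n : ℕ) : ℝ :=
  (Real.log n - 5 * Real.log (Real.log n) - Real.log (2 * Real.pi ^ 4)) / 2

/-- The point `z = 1 + √(γ / (4n)) + x / √(4γn) + i y / (γn)^(1/4)` with rescaled
coordinates `x, y`. -/
def point (n : ℕ) (x y : ℝ) : ℂ :=
  ((1 + √(scale n / (4 * n)) + x / √(4 * scale n * n) : ℝ) : ℂ)
    + Complex.I * ((y / (scale n * n) ^ (1 / 4 : ℝ) : ℝ) : ℂ)

/-- The half-plane `A(t) = {z : Re z ≥ 1 + √(γ / (4n)) + t / √(4γn)}`. -/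
def region (n : ℕ) (t : ℝ) : Set ℂ :=
  {z | 1 + √(scale n / (4 * n)) + t / √(4 * scale n * n) ≤ z.re}

/-- The closed upper half-plane, on which the operators act. -/
def upper : Set ℂ := {z | 0 ≤ z.im}

/-- The truncated exponential kernel `K_n(z, w) = ∑_{l < n} (n z w̄)^l / l!`. -/
def kernel (n : ℕ) (z w : ℂ) : ℂ :=
  ∑ l ∈ Finset.range n, ((n : ℂ) * z * conj w) ^ l / (Nat.factorial l : ℂ)

/-- The scalar kernel `S_n(z, w)` of the real Ginibre ensemble. -/
def scalarKernel (n : ℕ) (z w : ℂ) : ℂ :=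
  Complex.I * n * Complex.exp (-(n : ℂ) * (z - conj w) ^ 2 / 2) / (√(2 * Real.pi) : ℝ)
    * ((√(n : ℝ) : ℝ) : ℂ) * (conj w - z)
    * ((√(erfc (√(2 * n) * |z.im|) * erfc (√(2 * n) * |w.im|)) : ℝ) : ℂ)
    * Complex.exp (-(n : ℂ) * z * conj w) * kernel n z w

/-- The `2 × 2` matrix kernel `K_n^{ℂ,ℂ}(z, w)` of the real Ginibre ensemble. -/
def matrixKernel (n : ℕ) (z w : ℂ) : Matrix (Fin 2) (Fin 2) ℂ :=
  !![scalarKernel n z w, -Complex.I * scalarKernel n z (conj w);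
     -Complex.I * scalarKernel n (conj z) w, scalarKernel n w z]

/-- The conjugated kernel `√g(z) K(z, w) √g(w)`. -/
def sandwich (g : ℂ → ℝ) (K : ℂ → ℂ → Matrix (Fin 2) (Fin 2) ℂ) (z w : ℂ) :
    Matrix (Fin 2) (Fin 2) ℂ :=
  (((√(g z) * √(g w) : ℝ)) : ℂ) • K z w

/-- The trace `∫ tr K(z, z) d²z` of a matrix kernel over the upper half-plane. -/
def opTrace (K : ℂ → ℂ → Matrix (Fin 2) (Fin 2) ℂ) : ℂ :=
  ∫ z in upper, (K z z).trace

/-- The Hilbert-Schmidt norm `(∫∫ ∑_{i,j} |K(z, w)_{ij}|² d²w d²z)^(1/2)` of a matrix kernel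
over the upper half-plane, as an extended nonnegative real. -/
def hsNorm (K : ℂ → ℂ → Matrix (Fin 2) (Fin 2) ℂ) : ENNReal :=
  (∫⁻ z in upper, ∫⁻ w in upper, ∑ i, ∑ j, ‖K z w i j‖ₑ ^ 2) ^ (1 / 2 : ℝ)

end Ginibre

end

noncomputable section

namespace Ginibre

open Filter Topology Real Set

/-! ### The complementary error function -/

/-! Write `erfc s = exp (-s^2) * erfcx s`. The Gaussian released by the two `erfc` factors combines
with the exponentials in `S_n` into the weight `exp (-n(|z|^2+|w|^2)/2)`. On the diagonal,
`S_n(z,z)` becomes `n/π` times `√π s erfcx s`, where `s = √(2n) Im z`, times the Poisson probability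
`P(Poisson(n|z|^2) < n)` (`scalarKernel_self`). The first factor tends to 1 away from the real axis.
The second is evaluated by Abel summation: the coefficients `n^l/l!` increase up to `l = n`, so
multiplying the truncated exponential by `u - 1` leaves `n^n u^n/n!` up to a small defect
(`sub_one_mul_truncExp_le`, `le_sub_one_mul_truncExp`), and Stirling's formula gives the peak
weight.

Put `h = (γn)^(1/4)` and `v = x + y^2`. Then `|z|^2 - 1` is `(γ+v)/h^2` to leading order, and the
large deviation exponent is about `(γ+v)^2/(2γ) = γ/2 + v + v^2/(2γ)`. So the density is `2 exp
(-x-y^2)/√π` times a constant `normRatio`. The definition of `γ` makes the fourth power of this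
constant exactly `(log n/(2γ))^5` (`LargeDim.normRatio_pow`), hence it is `1 + O(log log n/log n)`.
The relative error, of order `(1+v^2)/γ` plus an integrable singularity at `y = 0`, is integrated in
`abs_trace_sub_le`.

For the Hilbert-Schmidt norm, complex Abel summation bounds `|z conj w - 1| |K_n|`, so that
`|S_n|^2` carries the ratio `|conj w - z|^2/|z conj w - 1|^2`. Two algebraic identities show that
this ratio is at most 1 when `Im z` and `Im w` have opposite signs, and otherwise at most 1 plus a
Cauchy kernel in `Im z - Im w`. Either contribution gains a factor `h/√n` over the trace scale
(`hsNorm_sandwich_le`). This is a negative power of `n` up to logarithms, far below `exp (-√(log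
n)/16)`.

These estimates need `n` large (`LargeDim.edgeEstimate`). Each of the finitely many remaining `n` is
covered by a Gaussian bound on the kernel (`exists_edgeEstimate`), the right-hand sides being
bounded below for `|t| ≤ √(log n)/10`. -/

lemma integrable_exp_neg_sq : Integrable (fun s : ℝ => exp (-s ^ 2)) := by
  simpa using integrable_exp_neg_mul_sq (b := 1) one_pos

lemma erfc_nonneg (x : ℝ) : 0 ≤ erfc x :=
  mul_nonneg (by positivity) (setIntegral_nonneg measurableSet_Ioi fun _ _ => (exp_pos _).le)

lemma erfc_antitone : Antitone erfc := by
  intro x y hxy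
  refine mul_le_mul_of_nonneg_left ?_ (by positivity)
  exact setIntegral_mono_set integrable_exp_neg_sq.integrableOn
    (Eventually.of_forall fun _ => (exp_pos _).le) (Ioi_subset_Ioi hxy).eventuallyLE

lemma measurable_erfc : Measurable erfc := erfc_antitone.measurable

/-- The scaled complementary error function `exp (s ^ 2) * erfc s`. -/
def erfcx (s : ℝ) : ℝ := exp (s ^ 2) * erfc s

lemma erfcx_nonneg (s : ℝ) : 0 ≤ erfcx s := mul_nonneg (exp_pos _).le (erfc_nonneg s)

lemma measurable_erfcx : Measurable erfcx := by
  unfold erfcx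
  exact (by fun_prop : Measurable fun s : ℝ => exp (s ^ 2)).mul measurable_erfc

lemma erfc_eq (s : ℝ) : erfc s = exp (-s ^ 2) * erfcx s := by
  rw [erfcx, ← mul_assoc, ← exp_add]; simp

/-- Shift the tail to the half-line from 0 and use `(v+s)^2 ≥ v^2 + s^2`. -/
lemma erfcx_le_one {s : ℝ} (hs : 0 ≤ s) : erfcx s ≤ 1 := by
  have h1 : ∫ u in Ioi s, exp (-u ^ 2) = ∫ v in Ioi (0 : ℝ), exp (-(v + s) ^ 2) := by
    rw [← integral_indicator measurableSet_Ioi, ← integral_indicator measurableSet_Ioi,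
      ← integral_add_right_eq_self _ s]
    congr 1; ext v
    simp [indicator]
  have h2 : ∫ v in Ioi (0 : ℝ), exp (-(v + s) ^ 2)
      ≤ ∫ v in Ioi (0 : ℝ), exp (-s ^ 2) * exp (-v ^ 2) := by
    refine setIntegral_mono_on ?_ ?_ measurableSet_Ioi ?_
    · exact (integrable_exp_neg_sq.comp_add_right s).integrableOn
    · exact (integrable_exp_neg_sq.const_mul _).integrableOn
    · intro v hv
      rw [← exp_add]
      exact exp_le_exp.2 (by nlinarith [mul_nonneg hs (le_of_lt (mem_Ioi.1 hv))])
  have h3 : ∫ v in Ioi (0 : ℝ), exp (-v ^ 2) = √π / 2 := by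
    simpa using integral_gaussian_Ioi 1
  rw [integral_const_mul, h3] at h2
  have hp : 0 < √π := by positivity
  calc erfcx s ≤ exp (s ^ 2) * (2 / √π * (exp (-s ^ 2) * (√π / 2))) := by
        unfold erfcx erfc; rw [h1]; gcongr
    _ = (exp (s ^ 2) * exp (-s ^ 2)) * (√π / √π) := by ring
    _ = 1 := by rw [← exp_add, div_self hp.ne']; simp

/-- Both Mills-ratio bounds come from this antiderivative: on `u > s` the correction `1/(2u^2)` lies
between 0 and `1/(2s^2)`. -/
lemma hasDerivAt_gaussian_tail {u : ℝ} (hu : u ≠ 0) :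
    HasDerivAt (fun u : ℝ => -(exp (-u ^ 2) / (2 * u))) (exp (-u ^ 2) * (1 + 1 / (2 * u ^ 2))) u := by
  have h1 : HasDerivAt (fun u : ℝ => exp (-u ^ 2)) (exp (-u ^ 2) * (-(2 * u))) u := by
    simpa using ((hasDerivAt_pow 2 u).neg).exp
  have h2 : HasDerivAt (fun u : ℝ => 2 * u) 2 u := by simpa using (hasDerivAt_id u).const_mul 2
  convert! (h1.div h2 (by simpa using hu)).neg using 1
  field_simp
  ring

lemma tendsto_gaussian_tail :
    Tendsto (fun u : ℝ => -(exp (-u ^ 2) / (2 * u))) atTop (𝓝 0) := by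
  have h1 : Tendsto (fun u : ℝ => (2 * u)⁻¹) atTop (𝓝 0) :=
    tendsto_inv_atTop_zero.comp (tendsto_id.const_mul_atTop two_pos)
  have h2 : Tendsto (fun u : ℝ => -((2 * u)⁻¹)) atTop (𝓝 0) := by simpa using h1.neg
  refine tendsto_of_tendsto_of_tendsto_of_le_of_le' h2 tendsto_const_nhds ?_ ?_
  · filter_upwards [eventually_gt_atTop 0] with u hu
    rw [div_eq_mul_inv]
    have : exp (-u ^ 2) ≤ 1 := exp_le_one_iff.2 (by nlinarith)
    have h3 : 0 < (2 * u)⁻¹ := by positivity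
    nlinarith
  · filter_upwards [eventually_gt_atTop 0] with u hu
    have : 0 < exp (-u ^ 2) / (2 * u) := by positivity
    linarith

lemma integral_gaussian_tail {s : ℝ} (hs : 0 < s) :
    IntegrableOn (fun u : ℝ => exp (-u ^ 2) * (1 + 1 / (2 * u ^ 2))) (Ioi s) ∧
    ∫ u in Ioi s, exp (-u ^ 2) * (1 + 1 / (2 * u ^ 2)) = exp (-s ^ 2) / (2 * s) := by
  have hd : ∀ u ∈ Ici s, HasDerivAt (fun u : ℝ => -(exp (-u ^ 2) / (2 * u)))
      (exp (-u ^ 2) * (1 + 1 / (2 * u ^ 2))) u :=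
    fun u hu => hasDerivAt_gaussian_tail (hs.trans_le hu).ne'
  have hi := integrableOn_Ioi_deriv_of_nonneg' hd (fun u _ => by positivity) tendsto_gaussian_tail
  refine ⟨hi, ?_⟩
  rw [integral_Ioi_of_hasDerivAt_of_tendsto' hd hi tendsto_gaussian_tail]
  ring

lemma mul_erfcx_le_one {s : ℝ} (hs : 0 < s) : √π * s * erfcx s ≤ 1 := by
  obtain ⟨hi, he⟩ := integral_gaussian_tail hs
  have h : ∫ u in Ioi s, exp (-u ^ 2) ≤ exp (-s ^ 2) / (2 * s) := by
    rw [← he]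
    refine setIntegral_mono_on integrable_exp_neg_sq.integrableOn hi measurableSet_Ioi ?_
    intro u _
    exact le_mul_of_one_le_right (exp_pos _).le (by simp; positivity)
  have hp : 0 < √π := by positivity
  calc √π * s * erfcx s
      ≤ √π * s * (exp (s ^ 2) * (2 / √π * (exp (-s ^ 2) / (2 * s)))) := by
        unfold erfcx erfc; gcongr
    _ = exp (s ^ 2) * exp (-s ^ 2) := by field_simp
    _ = 1 := by rw [← exp_add]; simp

lemma one_sub_mul_erfcx_le {s : ℝ} (hs : 0 < s) : 1 - √π * s * erfcx s ≤ 1 / (2 * s ^ 2) := by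
  obtain ⟨hi, he⟩ := integral_gaussian_tail hs
  have h : exp (-s ^ 2) / (2 * s) ≤ (∫ u in Ioi s, exp (-u ^ 2)) * (1 + 1 / (2 * s ^ 2)) := by
    rw [← he, ← integral_mul_const]
    refine setIntegral_mono_on hi (integrable_exp_neg_sq.mul_const _).integrableOn
      measurableSet_Ioi ?_
    intro u hu
    have hu' : s < u := hu
    gcongr
  have hp : 0 < √π := by positivity
  have h1 : 1 ≤ √π * s * erfcx s * (1 + 1 / (2 * s ^ 2)) := by
    calc (1 : ℝ) = exp (s ^ 2) * exp (-s ^ 2) := by rw [← exp_add]; simp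
      _ = √π * s * (exp (s ^ 2) * (2 / √π * (exp (-s ^ 2) / (2 * s)))) := by field_simp
      _ ≤ √π * s * (exp (s ^ 2) * (2 / √π *
          ((∫ u in Ioi s, exp (-u ^ 2)) * (1 + 1 / (2 * s ^ 2))))) := by gcongr
      _ = _ := by unfold erfcx erfc; ring
  have h2 := mul_erfcx_le_one hs
  have h3 : 0 < 1 / (2 * s ^ 2) := by positivity
  nlinarith

/-- The exponent `-1/2` is a compromise: `s^(-2)` is not integrable at the real axis, whereas this
power is, and it still decays in `n` after rescaling. -/
lemma one_sub_mul_erfcx_le_rpow {s : ℝ} (hs : 0 < s) :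
    1 - √π * s * erfcx s ≤ s ^ (-(1 / 2) : ℝ) := by
  rcases le_total s 1 with h | h
  · have h1 : 1 ≤ s ^ (-(1 / 2) : ℝ) := one_le_rpow_of_pos_of_le_one_of_nonpos hs h (by norm_num)
    have : 0 ≤ √π * s * erfcx s := by have := erfcx_nonneg s; positivity
    linarith
  · have h1 : s ^ (-2 : ℝ) ≤ s ^ (-(1 / 2) : ℝ) := rpow_le_rpow_of_exponent_le h (by norm_num)
    have h2 : s ^ (-2 : ℝ) = 1 / s ^ 2 := by
      rw [rpow_neg hs.le, one_div]; norm_cast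
    have h3 := one_sub_mul_erfcx_le hs
    have h4 : 1 / (2 * s ^ 2) ≤ 1 / s ^ 2 := by gcongr; nlinarith
    linarith

lemma erfcx_le_rpow {s : ℝ} (hs : 0 < s) : erfcx s ≤ s ^ (-(1 / 2) : ℝ) := by
  rcases le_total s 1 with h | h
  · exact (erfcx_le_one hs.le).trans
      (one_le_rpow_of_pos_of_le_one_of_nonpos hs h (by norm_num))
  · have h1 : s ^ (-1 : ℝ) ≤ s ^ (-(1 / 2) : ℝ) := rpow_le_rpow_of_exponent_le h (by norm_num)
    have h2 := mul_erfcx_le_one hs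
    have h3 : 1 ≤ √π := one_le_sqrt.2 (by linarith [pi_gt_three])
    have h4 := erfcx_nonneg s
    rw [rpow_neg_one] at h1
    refine le_trans ?_ h1
    rw [← one_div, le_div_iff₀ hs]
    nlinarith [mul_nonneg hs.le h4]

/-! ### The truncated exponential series -/

/-- The truncated exponential series `∑_{l < m} (n u)^l / l!`. -/
def truncExp (n m : ℕ) (u : ℝ) : ℝ := ∑ l ∈ Finset.range m, (n * u) ^ l / (Nat.factorial l : ℝ)

/-- The Taylor coefficient `n ^ l / l!`. -/
def coef (n l : ℕ) : ℝ := (n : ℝ) ^ l / (Nat.factorial l : ℝ)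

lemma coef_nonneg (n l : ℕ) : 0 ≤ coef n l := by unfold coef; positivity

lemma coef_pred (n l : ℕ) : coef n (l + 1) * ((l + 1 : ℕ) : ℝ) = n * coef n l := by
  unfold coef
  rw [Nat.factorial_succ, pow_succ]
  push_cast
  field_simp

lemma coef_mono {n l : ℕ} (hl : l + 1 ≤ n) : coef n l ≤ coef n (l + 1) := by
  have h := coef_pred n l
  have h1 : ((l + 1 : ℕ) : ℝ) ≤ n := by exact_mod_cast hl
  have h2 : (0 : ℝ) < n := by exact_mod_cast (by omega : 0 < n)
  have h3 := coef_nonneg n (l + 1)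
  nlinarith

lemma coef_le_last {n l : ℕ} (hl : l ≤ n) : coef n l ≤ coef n n := by
  induction hl using Nat.decreasingInduction with
  | of_succ k hk ih => exact (coef_mono hk).trans ih
  | self => exact le_rfl

lemma truncExp_succ (n m : ℕ) (u : ℝ) :
    truncExp n (m + 1) u = truncExp n m u + coef n m * u ^ m := by
  unfold truncExp coef
  rw [Finset.sum_range_succ, mul_pow]; ring

lemma truncExp_nonneg (n m : ℕ) {u : ℝ} (hu : 0 ≤ u) : 0 ≤ truncExp n m u :=
  Finset.sum_nonneg fun _ _ => by positivity

/-- Abel summation with the nondecreasing coefficients `n^l/l!`, `l ≤ n`; leaving `m` free lets the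
telescoping run as an induction. -/
lemma sub_one_mul_truncExp_le {n m : ℕ} (hm : m ≤ n) {u : ℝ} (hu : 1 ≤ u) :
    (u - 1) * truncExp n m u ≤ coef n m * u ^ m := by
  induction m with
  | zero => simp [truncExp, coef]
  | succ m ih =>
    have h1 := ih (by omega)
    have h2 := coef_mono hm
    have h3 : coef n m * u ^ (m + 1) ≤ coef n (m + 1) * u ^ (m + 1) := by gcongr
    rw [truncExp_succ]
    calc _ = (u - 1) * truncExp n m u + (u - 1) * (coef n m * u ^ m) := by ring
      _ ≤ coef n m * u ^ m + (u - 1) * (coef n m * u ^ m) := by linarith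
      _ = coef n m * u ^ (m + 1) := by ring
      _ ≤ _ := h3

/-- The defect is the sum of `(c_l - c_{l-1}) u^l` with `c_l - c_{l-1} = c_l (n-l)/n`, where `c_l =
n^l/l!`. Bounding `c_l` by `c_n` and extending the sum of `(n-l) u^l` to `l → -∞` gives the
right-hand side in closed form, which is why the induction step closes with equality. -/
lemma defect_le {n m : ℕ} (hn : 0 < n) (hm : m ≤ n) {u : ℝ} (hu : 1 < u) :
    coef n m * u ^ m - (u - 1) * truncExp n m u
      ≤ coef n n / n * u ^ (m + 1) * ((n - m) / (u - 1) + 1 / (u - 1) ^ 2) := by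
  have hu1 : 0 < u - 1 := by linarith
  have hn' : (0 : ℝ) < n := by exact_mod_cast hn
  induction m with
  | zero =>
    have h1 : 1 ≤ coef n n := by
      have := coef_le_last (Nat.zero_le n); simpa [coef] using this
    have h2 : (n : ℝ) ≤ u * (n / (u - 1)) := by
      rw [← mul_div_assoc, le_div_iff₀ hu1]; nlinarith
    have h3 : 0 ≤ u * (1 / (u - 1) ^ 2) := by positivity
    have h4 : (1 : ℝ) ≤ coef n n / n * n := by rw [div_mul_cancel₀ _ hn'.ne']; exact h1
    have h5 : 0 ≤ coef n n / n := div_nonneg (coef_nonneg _ _) hn'.le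
    calc _ = (1 : ℝ) := by simp [truncExp, coef]
      _ ≤ coef n n / n * n := h4
      _ ≤ coef n n / n * (u * (n / (u - 1)) + u * (1 / (u - 1) ^ 2)) := by gcongr; linarith
      _ = _ := by simp; ring
  | succ m ih =>
    have h1 := ih (by omega)
    have h2 := coef_pred n m
    have h3 : coef n (m + 1) - coef n m = coef n (m + 1) / n * (n - (m + 1 : ℕ)) := by
      field_simp; linarith
    have h4 : (0 : ℝ) ≤ n - (m + 1 : ℕ) := by
      have : ((m + 1 : ℕ) : ℝ) ≤ n := by exact_mod_cast hm
      linarith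
    have h5 := coef_le_last hm
    have h6 : (coef n (m + 1) - coef n m) * u ^ (m + 1)
        ≤ coef n n / n * (n - (m + 1 : ℕ)) * u ^ (m + 1) := by rw [h3]; gcongr
    rw [truncExp_succ]
    calc _ = (coef n m * u ^ m - (u - 1) * truncExp n m u)
          + (coef n (m + 1) - coef n m) * u ^ (m + 1) := by ring
      _ ≤ coef n n / n * u ^ (m + 1) * ((n - m) / (u - 1) + 1 / (u - 1) ^ 2)
          + coef n n / n * (n - (m + 1 : ℕ)) * u ^ (m + 1) := add_le_add h1 h6
      _ = _ := by push_cast; field_simp; ring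

lemma le_sub_one_mul_truncExp {n : ℕ} (hn : 0 < n) {u : ℝ} (hu : 1 < u) :
    coef n n * u ^ n * (1 - u / (n * (u - 1) ^ 2)) ≤ (u - 1) * truncExp n n u := by
  have h := defect_le hn le_rfl hu
  have hu1 : 0 < u - 1 := by linarith
  have hn' : (0 : ℝ) < n := by exact_mod_cast hn
  have : coef n n / n * u ^ (n + 1) * (((n : ℝ) - n) / (u - 1) + 1 / (u - 1) ^ 2)
      = coef n n * u ^ n * (u / (n * (u - 1) ^ 2)) := by
    field_simp; ring
  rw [this] at h
  linarith

/-- The Abel increments are nonnegative, so the triangle inequality loses only the phases and the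
bounds telescope again. -/
lemma norm_sub_one_mul_truncExp_sub_le {n m : ℕ} (hm : m ≤ n) {ζ : ℂ} (hζ : 1 ≤ ‖ζ‖) :
    ‖(ζ - 1) * ∑ l ∈ Finset.range m, (n * ζ) ^ l / (Nat.factorial l : ℂ) - coef n m * ζ ^ m‖
      ≤ coef n m * ‖ζ‖ ^ m := by
  induction m with
  | zero => simp [coef]
  | succ m ih =>
    have h1 := ih (by omega)
    have h2 := coef_mono hm
    have h3 : (n * ζ) ^ m / (Nat.factorial m : ℂ) = coef n m * ζ ^ m := by
      unfold coef; push_cast; rw [mul_pow]; ring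
    rw [Finset.sum_range_succ, h3]
    calc _ = ‖((ζ - 1) * ∑ l ∈ Finset.range m, (n * ζ) ^ l / (Nat.factorial l : ℂ)
              - coef n m * ζ ^ m) - ((coef n (m + 1) - coef n m : ℝ) : ℂ) * ζ ^ (m + 1)‖ := by
          congr 1; push_cast; ring
      _ ≤ coef n m * ‖ζ‖ ^ m + (coef n (m + 1) - coef n m) * ‖ζ‖ ^ (m + 1) := by
          refine (norm_sub_le _ _).trans (add_le_add h1 ?_)
          rw [norm_mul, norm_pow, Complex.norm_real, norm_of_nonneg (by linarith)]
      _ ≤ coef n m * ‖ζ‖ ^ (m + 1) + (coef n (m + 1) - coef n m) * ‖ζ‖ ^ (m + 1) := by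
          have := coef_nonneg n m
          gcongr
          · omega
      _ = _ := by ring

lemma norm_sub_one_mul_kernel_le {n : ℕ} {z w : ℂ} (h : 1 ≤ ‖z‖ * ‖w‖) :
    ‖z * conj w - 1‖ * ‖kernel n z w‖ ≤ 2 * coef n n * (‖z‖ * ‖w‖) ^ n := by
  have hζ : ‖z * conj w‖ = ‖z‖ * ‖w‖ := by simp
  have h1 := norm_sub_one_mul_truncExp_sub_le (le_refl n) (hζ ▸ h)
  have h2 : kernel n z w
      = ∑ l ∈ Finset.range n, (n * (z * conj w)) ^ l / (Nat.factorial l : ℂ) := by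
    unfold kernel; simp only [mul_assoc]
  rw [← norm_mul, h2]
  set X := (z * conj w - 1) * ∑ l ∈ Finset.range n, (n * (z * conj w)) ^ l / (Nat.factorial l : ℂ)
  have h3 : ‖(coef n n : ℂ) * (z * conj w) ^ n‖ = coef n n * (‖z‖ * ‖w‖) ^ n := by
    rw [norm_mul, norm_pow, hζ, Complex.norm_real, norm_of_nonneg (coef_nonneg _ _)]
  calc ‖X‖ = ‖(X - coef n n * (z * conj w) ^ n) + coef n n * (z * conj w) ^ n‖ := by
        congr 1; ring
    _ ≤ coef n n * (‖z‖ * ‖w‖) ^ n + coef n n * (‖z‖ * ‖w‖) ^ n := by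
        refine (norm_add_le _ _).trans (add_le_add ?_ h3.le)
        rw [← hζ]; exact h1
    _ = _ := by ring

/-! ### Stirling's formula -/

/-- The Poisson weight `e ^ (-n) n ^ n / n!`. -/
def poissonPeak (n : ℕ) : ℝ := exp (-n) * coef n n

lemma poissonPeak_nonneg (n : ℕ) : 0 ≤ poissonPeak n := mul_nonneg (exp_pos _).le (coef_nonneg _ _)

lemma poissonPeak_mul_sqrt {n : ℕ} (hn : 0 < n) :
    poissonPeak n * √(2 * π * n) = √π / Stirling.stirlingSeq n := by
  have hn' : (0 : ℝ) < n := by exact_mod_cast hn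
  have h1 : √(2 * π * n) = √π * √(2 * n) := by
    rw [← sqrt_mul pi_pos.le]; congr 1; ring
  unfold poissonPeak coef Stirling.stirlingSeq
  rw [h1, div_pow, ← exp_nat_mul, exp_neg]
  have : (0 : ℝ) < √(2 * n) := by positivity
  field_simp

lemma poissonPeak_mul_sqrt_le {n : ℕ} (hn : 0 < n) : poissonPeak n * √(2 * π * n) ≤ 1 := by
  rw [poissonPeak_mul_sqrt hn]
  have h := Stirling.sqrt_pi_le_stirlingSeq hn.ne'
  have : 0 < √π := by positivity
  rw [div_le_one (this.trans_le h)]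
  exact h

/-- The sequence `log (stirlingSeq n) - 1/(12n)` increases to `log √π`, hence stays below it; then
apply `1 + x ≤ exp x`. -/
lemma le_poissonPeak_mul_sqrt {n : ℕ} (hn : 0 < n) :
    1 - 1 / (12 * n) ≤ poissonPeak n * √(2 * π * n) := by
  have hmono : Monotone fun k : ℕ =>
      log (Stirling.stirlingSeq (k + 1)) - 1 / (12 * ((k : ℝ) + 1)) := by
    refine monotone_nat_of_le_succ fun k => ?_
    have h := Stirling.log_stirlingSeq_sdiff_le (k + 1)
    push_cast at h ⊢
    have h2 : (1 : ℝ) / (12 * (k + 1)) - 1 / (12 * (k + 1 + 1)) = 1 / (12 * (k + 1) * (k + 1 + 1)) := by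
      field_simp; ring
    linarith
  have hlim : Tendsto (fun k : ℕ =>
      log (Stirling.stirlingSeq (k + 1)) - 1 / (12 * ((k : ℝ) + 1))) atTop (𝓝 (log √π)) := by
    have h1 : Tendsto (fun k : ℕ => log (Stirling.stirlingSeq (k + 1))) atTop (𝓝 (log √π)) :=
      (Stirling.tendsto_stirlingSeq_sqrt_pi.comp (tendsto_add_atTop_nat 1)).log (by positivity)
    have h2 : Tendsto (fun k : ℕ => 1 / (12 * ((k : ℝ) + 1))) atTop (𝓝 0) := by
      have := (tendsto_one_div_add_atTop_nhds_zero_nat (𝕜 := ℝ)).const_mul (1 / 12)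
      rw [mul_zero] at this
      refine this.congr fun k => ?_
      field_simp
    simpa using h1.sub h2
  obtain ⟨k, rfl⟩ : ∃ k, n = k + 1 := ⟨n - 1, by omega⟩
  have h := hmono.ge_of_tendsto hlim k
  have hs : 0 < Stirling.stirlingSeq (k + 1) := Stirling.stirlingSeq'_pos k
  have hp : 0 < √π := by positivity
  rw [poissonPeak_mul_sqrt hn]
  have h3 : -(1 / (12 * ((k + 1 : ℕ) : ℝ))) ≤ log (√π / Stirling.stirlingSeq (k + 1)) := by
    rw [log_div hp.ne' hs.ne']; push_cast; linarith
  have h4 := exp_le_exp.2 h3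
  rw [exp_log (by positivity)] at h4
  linarith [add_one_le_exp (-(1 / (12 * ((k + 1 : ℕ) : ℝ))))]

/-! ### The Poisson tail -/

/-- The Poisson probability `e ^ (-n u) ∑_{l < n} (n u)^l / l!`. -/
def poissonTail (n : ℕ) (u : ℝ) : ℝ := exp (-(n * u)) * truncExp n n u

/-- The large deviation weight `u ^ n e ^ (-n (u - 1))`. -/
def ldWeight (n : ℕ) (u : ℝ) : ℝ := u ^ n * exp (-(n * (u - 1)))

lemma poissonTail_nonneg (n : ℕ) {u : ℝ} (hu : 0 ≤ u) : 0 ≤ poissonTail n u :=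
  mul_nonneg (exp_pos _).le (truncExp_nonneg _ _ hu)

lemma ldWeight_nonneg (n : ℕ) {u : ℝ} (hu : 0 ≤ u) : 0 ≤ ldWeight n u := by
  unfold ldWeight; positivity

lemma exp_mul_coef (n : ℕ) (u : ℝ) :
    exp (-(n * u)) * (coef n n * u ^ n) = poissonPeak n * ldWeight n u := by
  unfold poissonPeak ldWeight
  have : exp (-(n * u)) = exp (-(n : ℝ)) * exp (-(n * (u - 1))) := by
    rw [← exp_add]; congr 1; ring
  rw [this]; ring

lemma poissonTail_le (n : ℕ) {u : ℝ} (hu : 1 < u) :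
    poissonTail n u ≤ poissonPeak n * ldWeight n u / (u - 1) := by
  rw [le_div_iff₀ (by linarith), ← exp_mul_coef, poissonTail, mul_assoc]
  have := sub_one_mul_truncExp_le (le_refl n) hu.le
  exact mul_le_mul_of_nonneg_left (by linarith) (exp_pos _).le

lemma le_poissonTail {n : ℕ} (hn : 0 < n) {u : ℝ} (hu : 1 < u) :
    poissonPeak n * ldWeight n u / (u - 1) * (1 - u / (n * (u - 1) ^ 2)) ≤ poissonTail n u := by
  rw [div_mul_eq_mul_div, div_le_iff₀ (by linarith), ← exp_mul_coef, poissonTail]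
  have := mul_le_mul_of_nonneg_left (le_sub_one_mul_truncExp hn hu) (exp_pos (-(n * u))).le
  linarith

lemma ldWeight_eq_exp (n : ℕ) {u : ℝ} (hu : 0 < u) :
    ldWeight n u = exp (-(n * (u - 1 - log u))) := by
  unfold ldWeight
  rw [← exp_log (pow_pos hu n), ← exp_add, log_pow]
  congr 1; ring

lemma sub_log_le {δ : ℝ} (hδ : 0 ≤ δ) : δ - log (1 + δ) ≤ δ ^ 2 / 2 := by
  have := le_log_one_add_of_nonneg hδ
  have h2 : δ - δ ^ 2 / 2 ≤ 2 * δ / (δ + 2) := by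
    rw [le_div_iff₀ (by positivity)]
    nlinarith [pow_nonneg hδ 3]
  linarith

/-- The difference of the two sides vanishes at 0 and has derivative `x^2/(2(1+x)^2)`. -/
lemma le_sub_log {δ : ℝ} (hδ : 0 ≤ δ) : δ ^ 2 / (2 * (1 + δ)) ≤ δ - log (1 + δ) := by
  have hmono : MonotoneOn (fun x : ℝ => x - log (1 + x) - x ^ 2 / (2 * (1 + x))) (Ici 0) := by
    have hd : ∀ x : ℝ, 0 ≤ x → HasDerivAt (fun x : ℝ => x - log (1 + x) - x ^ 2 / (2 * (1 + x)))
        (x ^ 2 / (2 * (1 + x) ^ 2)) x := by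
      intro x hx
      have h0 : HasDerivAt (fun x : ℝ => 1 + x) 1 x := by simpa using (hasDerivAt_id x).const_add 1
      have h1 := h0.log (by positivity)
      have h2 := (hasDerivAt_pow 2 x).div (h0.const_mul 2) (by positivity)
      convert! ((hasDerivAt_id x).sub h1).sub h2 using 1
      have : 1 + x ≠ 0 := by positivity
      field_simp
      simp
      ring
    refine monotoneOn_of_deriv_nonneg (convex_Ici 0)
      (fun x hx => (hd x hx).continuousAt.continuousWithinAt) ?_ ?_
    · intro x hx
      rw [interior_Ici] at hx
      exact (hd x (le_of_lt hx)).differentiableAt.differentiableWithinAt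
    · intro x hx
      rw [interior_Ici] at hx
      rw [(hd x (le_of_lt hx)).deriv]
      positivity
  have := hmono (self_mem_Ici) (mem_Ici.2 hδ) hδ
  simp at this
  linarith

/-! ### The scalar kernel -/

lemma kernel_self (n : ℕ) (z : ℂ) : kernel n z z = (truncExp n n (‖z‖ ^ 2) : ℝ) := by
  unfold kernel truncExp
  push_cast
  refine Finset.sum_congr rfl fun l _ => ?_
  rw [mul_assoc, Complex.mul_conj, Complex.normSq_eq_norm_sq]
  push_cast; rfl

lemma sqrt_erfc_mul (n : ℕ) (b d : ℝ) :
    √(erfc (√(2 * n) * |b|) * erfc (√(2 * n) * |d|))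
      = exp (-(n * (b ^ 2 + d ^ 2))) * √(erfcx (√(2 * n) * |b|) * erfcx (√(2 * n) * |d|)) := by
  have h2 : √(2 * (n : ℝ)) ^ 2 = 2 * n := sq_sqrt (by positivity)
  have : erfc (√(2 * n) * |b|) * erfc (√(2 * n) * |d|)
      = exp (-(n * (b ^ 2 + d ^ 2))) ^ 2 * (erfcx (√(2 * n) * |b|) * erfcx (√(2 * n) * |d|)) := by
    rw [erfc_eq (_ * |b|), erfc_eq (_ * |d|), ← exp_nat_mul]
    have : exp ((2 : ℕ) * (-(n * (b ^ 2 + d ^ 2))))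
        = exp (-(√(2 * n) * |b|) ^ 2) * exp (-(√(2 * n) * |d|) ^ 2) := by
      rw [← exp_add]; congr 1
      simp only [mul_pow, sq_abs, h2]
      push_cast; ring
    rw [this]; ring
  rw [this, sqrt_mul (by positivity), sqrt_sq (exp_pos _).le]

lemma norm_scalarKernel (n : ℕ) (z w : ℂ) :
    ‖scalarKernel n z w‖ = n * √n / √(2 * π) * ‖conj w - z‖
      * √(erfcx (√(2 * n) * |z.im|) * erfcx (√(2 * n) * |w.im|))
      * exp (-(n * (‖z‖ ^ 2 + ‖w‖ ^ 2) / 2)) * ‖kernel n z w‖ := by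
  unfold scalarKernel
  simp only [norm_mul, norm_div, Complex.norm_I, Complex.norm_natCast, Complex.norm_exp,
    Complex.norm_real, norm_of_nonneg (sqrt_nonneg _), one_mul]
  rw [sqrt_erfc_mul]
  have h1 : (-(n : ℂ) * (z - conj w) ^ 2 / 2).re
      = -(n * ((z.re - w.re) ^ 2 - (z.im + w.im) ^ 2) / 2) := by
    simp [pow_two]
    ring
  have h2 : (-(n : ℂ) * z * conj w).re = -(n * (z.re * w.re + z.im * w.im)) := by
    simp; ring
  -- The growth of `exp (-n(z - conj w)^2/2)` in the imaginary direction is cancelled by the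
  -- Gaussians taken out of `erfc`.
  have h3 : exp (-(n * (‖z‖ ^ 2 + ‖w‖ ^ 2) / 2))
      = exp (-(n * ((z.re - w.re) ^ 2 - (z.im + w.im) ^ 2) / 2))
        * exp (-(n * (z.im ^ 2 + w.im ^ 2))) * exp (-(n * (z.re * w.re + z.im * w.im))) := by
    rw [← exp_add, ← exp_add, Complex.sq_norm, Complex.sq_norm, Complex.normSq_apply,
      Complex.normSq_apply]
    congr 1; ring
  rw [h1, h2, h3]
  ring

lemma scalarKernel_self (n : ℕ) {z : ℂ} (hz : 0 ≤ z.im) :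
    scalarKernel n z z = ((n / π * (√π * (√(2 * n) * z.im) * erfcx (√(2 * n) * z.im))
      * poissonTail n (‖z‖ ^ 2) : ℝ) : ℂ) := by
  unfold scalarKernel poissonTail
  rw [kernel_self, sqrt_erfc_mul, abs_of_nonneg hz, sqrt_mul_self (erfcx_nonneg _)]
  have h1 : z - conj z = ((2 * z.im : ℝ) : ℂ) * Complex.I := Complex.sub_conj z
  have h2 : conj z - z = -(((2 * z.im : ℝ) : ℂ) * Complex.I) := by rw [← h1]; ring
  have h3 : -(n : ℂ) * z * conj z = ((-(n * ‖z‖ ^ 2) : ℝ) : ℂ) := by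
    rw [mul_assoc, Complex.mul_conj, Complex.normSq_eq_norm_sq]; push_cast; ring
  have h4 : -(n : ℂ) * (z - conj z) ^ 2 / 2 = ((n * (z.im ^ 2 + z.im ^ 2) : ℝ) : ℂ) := by
    rw [h1, mul_pow, Complex.I_sq]; push_cast; ring
  rw [h2, h3, h4]
  have h5 : Complex.I * (n : ℂ) * Complex.exp ((n * (z.im ^ 2 + z.im ^ 2) : ℝ) : ℂ)
      / ((√(2 * π) : ℝ) : ℂ) * ((√(n : ℝ) : ℝ) : ℂ) * -(((2 * z.im : ℝ) : ℂ) * Complex.I)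
      = ((n * exp (n * (z.im ^ 2 + z.im ^ 2)) / √(2 * π) * √n * (2 * z.im) : ℝ) : ℂ) := by
    push_cast
    linear_combination (-((n : ℂ) * Complex.exp (n * (z.im ^ 2 + z.im ^ 2))
      / ((√(2 * π) : ℝ) : ℂ) * ((√(n : ℝ) : ℝ) : ℂ) * (2 * z.im))) * Complex.I_mul_I
  rw [h5, ← Complex.ofReal_exp]
  simp only [← Complex.ofReal_mul, Complex.ofReal_inj]
  have h6 : exp (n * (z.im ^ 2 + z.im ^ 2)) * exp (-(n * (z.im ^ 2 + z.im ^ 2))) = 1 := by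
    rw [← exp_add]; simp
  have h7 : n / √(2 * π) * √n * (2 * z.im) = n / π * (√π * (√(2 * n) * z.im)) := by
    rw [sqrt_mul two_pos.le, sqrt_mul two_pos.le]
    have hp : 0 < √π := by positivity
    have h2 : 0 < √(2 : ℝ) := by positivity
    have h8 : √π ^ 2 = π := sq_sqrt pi_pos.le
    have h9 : √(2 : ℝ) ^ 2 = 2 := sq_sqrt two_pos.le
    field_simp
    rw [h8, h9]
    ring
  calc _ = (n / √(2 * π) * √n * (2 * z.im)) * (exp (n * (z.im ^ 2 + z.im ^ 2))
        * exp (-(n * (z.im ^ 2 + z.im ^ 2)))) * erfcx (√(2 * n) * z.im)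
        * (exp (-(n * ‖z‖ ^ 2)) * truncExp n n (‖z‖ ^ 2)) := by ring
    _ = _ := by rw [h6, h7]; ring

/-- For `z`, `w` outside the unit disc this bounds the Abel denominator below, both by `|z-w|^2` and
by a positive quantity. -/
lemma norm_one_sub_mul_conj_sq (z w : ℂ) :
    ‖z * conj w - 1‖ ^ 2 = ‖z - w‖ ^ 2 + (‖z‖ ^ 2 - 1) * (‖w‖ ^ 2 - 1) := by
  simp only [Complex.sq_norm, Complex.normSq_apply]
  simp; ring

/-- The sign of `Im z * Im w` thus decides whether `|conj w - z|` can exceed `|z conj w - 1|`. -/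
lemma norm_conj_sub_sq (z w : ℂ) :
    ‖conj w - z‖ ^ 2 = ‖z - w‖ ^ 2 + 4 * (z.im * w.im) := by
  simp only [Complex.sq_norm, Complex.normSq_apply]
  simp; ring

lemma sq_norm_scalarKernel_le {n : ℕ} (hn : 0 < n) {z w : ℂ} (hz : 1 < ‖z‖) (hw : 1 < ‖w‖) :
    ‖scalarKernel n z w‖ ^ 2 ≤ (n / π) ^ 2
      * (erfcx (√(2 * n) * |z.im|) * erfcx (√(2 * n) * |w.im|))
      * (ldWeight n (‖z‖ ^ 2) * ldWeight n (‖w‖ ^ 2))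
      * (‖conj w - z‖ ^ 2 / ‖z * conj w - 1‖ ^ 2) := by
  have hn' : (0 : ℝ) < n := by exact_mod_cast hn
  have hzw : 1 < ‖z‖ * ‖w‖ := by nlinarith
  have hpos : 0 < ‖z * conj w - 1‖ := by
    rw [norm_pos_iff, sub_ne_zero]
    intro h
    have := congrArg norm h
    simp at this
    linarith
  have hk := norm_sub_one_mul_kernel_le (n := n) hzw.le
  have hk2 : ‖kernel n z w‖ ^ 2
      ≤ (2 * coef n n * (‖z‖ * ‖w‖) ^ n) ^ 2 / ‖z * conj w - 1‖ ^ 2 := by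
    rw [le_div_iff₀ (by positivity), ← mul_pow, mul_comm]
    gcongr
  have hE := mul_nonneg (erfcx_nonneg (√(2 * n) * |z.im|)) (erfcx_nonneg (√(2 * n) * |w.im|))
  have hpk : poissonPeak n ^ 2 * (2 * π * n) ≤ 1 := by
    have h := poissonPeak_mul_sqrt_le hn
    have h2 : 0 ≤ poissonPeak n * √(2 * π * n) := mul_nonneg (poissonPeak_nonneg n) (sqrt_nonneg _)
    have h3 : (poissonPeak n * √(2 * π * n)) ^ 2 ≤ 1 := pow_le_one₀ h2 h
    rwa [mul_pow, sq_sqrt (by positivity)] at h3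
  have hphi : exp (-(n * (‖z‖ ^ 2 + ‖w‖ ^ 2) / 2)) ^ 2 * (coef n n * (‖z‖ * ‖w‖) ^ n) ^ 2
      = poissonPeak n ^ 2 * (ldWeight n (‖z‖ ^ 2) * ldWeight n (‖w‖ ^ 2)) := by
    have e1 := exp_mul_coef n (‖z‖ ^ 2)
    have e2 := exp_mul_coef n (‖w‖ ^ 2)
    calc _ = (exp (-(n * ‖z‖ ^ 2)) * (coef n n * (‖z‖ ^ 2) ^ n))
          * (exp (-(n * ‖w‖ ^ 2)) * (coef n n * (‖w‖ ^ 2) ^ n)) := by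
          have : exp (-(n * (‖z‖ ^ 2 + ‖w‖ ^ 2) / 2)) ^ 2
              = exp (-(n * ‖z‖ ^ 2)) * exp (-(n * ‖w‖ ^ 2)) := by
            rw [← exp_nat_mul, ← exp_add]; congr 1; push_cast; ring
          rw [this]; ring
      _ = _ := by rw [e1, e2]; ring
  have hW : 0 ≤ ldWeight n (‖z‖ ^ 2) * ldWeight n (‖w‖ ^ 2) :=
    mul_nonneg (ldWeight_nonneg _ (by positivity)) (ldWeight_nonneg _ (by positivity))
  rw [norm_scalarKernel]
  simp only [mul_pow, div_pow]
  rw [sq_sqrt hE, sq_sqrt hn'.le, sq_sqrt (by positivity)]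
  set E := erfcx (√(2 * n) * |z.im|) * erfcx (√(2 * n) * |w.im|)
  set W := ldWeight n (‖z‖ ^ 2) * ldWeight n (‖w‖ ^ 2)
  set R := ‖conj w - z‖ ^ 2
  set D := ‖z * conj w - 1‖ ^ 2
  have hD : 0 < D := by positivity
  have hR : 0 ≤ R := by positivity
  calc _ ≤ (n : ℝ) ^ 2 * n / (2 * π) * R * E * exp (-(n * (‖z‖ ^ 2 + ‖w‖ ^ 2) / 2)) ^ 2
        * ((2 * coef n n * (‖z‖ * ‖w‖) ^ n) ^ 2 / D) := by gcongr
    _ = (n : ℝ) ^ 2 * n / (2 * π) * 4 * E * (exp (-(n * (‖z‖ ^ 2 + ‖w‖ ^ 2) / 2)) ^ 2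
        * (coef n n * (‖z‖ * ‖w‖) ^ n) ^ 2) * (R / D) := by ring
    -- The factor 4 from the doubled Abel bound turns `n^3/(2π)` into `2n^3/π = (n/π)^2 · 2πn`,
    -- exactly the normalization of Stirling's bound.
    _ = (poissonPeak n ^ 2 * (2 * π * n)) * ((n : ℝ) ^ 2 / π ^ 2 * E * W * (R / D)) := by
        rw [hphi]; field_simp; ring
    _ ≤ 1 * ((n : ℝ) ^ 2 / π ^ 2 * E * W * (R / D)) := by gcongr
    _ = _ := by ring

/-! ### Pointwise asymptotics near the edge -/

/-- The parameter regime of the edge asymptotics: `h ^ 4 = γ n`, with `γ` at least one and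
`32 γ ^ 2 / h ^ 2` at most `ε ≤ 1`. -/
structure EdgeRegime (n : ℕ) (γ h ε : ℝ) : Prop where
  n_pos : 0 < n
  one_le : 1 ≤ γ
  h_pos : 0 < h
  h_pow : h ^ 4 = γ * n
  ε_le : ε ≤ 1
  small : 32 * γ ^ 2 ≤ ε * h ^ 2

namespace EdgeRegime

variable {n : ℕ} {γ h ε : ℝ}

lemma γ_pos (H : EdgeRegime n γ h ε) : 0 < γ := one_pos.trans_le H.one_le

lemma n_pos' (H : EdgeRegime n γ h ε) : (0 : ℝ) < n := by exact_mod_cast H.n_pos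

lemma ε_pos (H : EdgeRegime n γ h ε) : 0 < ε := by
  have h1 := H.small
  have h2 := H.γ_pos
  have h3 : 0 < h ^ 2 := pow_pos H.h_pos 2
  have h4 : 0 < ε * h ^ 2 := lt_of_lt_of_le (by positivity) h1
  exact pos_of_mul_pos_left h4 h3.le

lemma sq_le (H : EdgeRegime n γ h ε) : 32 * γ ^ 2 ≤ h ^ 2 := by
  have := H.small
  have := mul_le_mul_of_nonneg_right H.ε_le (sq_nonneg h)
  linarith

lemma γ_le (H : EdgeRegime n γ h ε) : γ ≤ n := by
  have h1 := H.one_le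
  have h2 : (32 * γ ^ 2) ^ 2 ≤ (h ^ 2) ^ 2 := pow_le_pow_left₀ (by positivity) H.sq_le 2
  have h3 : γ * (1024 * γ ^ 3) ≤ γ * n := by rw [← H.h_pow]; linarith
  have h4 := le_of_mul_le_mul_left h3 H.γ_pos
  nlinarith [one_le_pow₀ (n := 2) h1]

lemma n_mul_sq (H : EdgeRegime n γ h ε) (b : ℝ) : n * (b / h ^ 2) ^ 2 = b ^ 2 / γ := by
  have := H.γ_pos
  have h1 := H.h_pos
  rw [div_pow, ← pow_mul, H.h_pow]
  have := H.n_pos'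
  field_simp

/-- Far from the edge the quadratic expansion of the rate fails, but linear decay is enough; the
lower bound `δ^2/(2(1+δ))` for the rate is increasing in `δ`. -/
lemma ldWeight_le_of_far (H : EdgeRegime n γ h ε) {b δ : ℝ} (hb : 4 * γ ≤ b)
    (hδ : b / h ^ 2 ≤ δ) : ldWeight n (1 + δ) ≤ exp (-b) := by
  have hγ := H.γ_pos
  have hb0 : 0 < b := by linarith
  have hh : 0 < h ^ 2 := pow_pos H.h_pos 2
  have hn := H.n_pos'
  set δ₀ := b / h ^ 2 with hδ₀
  have hδ₀p : 0 < δ₀ := by positivity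
  have hδp : 0 < δ := hδ₀p.trans_le hδ
  rw [ldWeight_eq_exp n (by positivity)]
  refine exp_le_exp.2 (neg_le_neg ?_)
  have h1 := le_sub_log hδp.le
  have h2 : δ₀ ^ 2 / (2 * (1 + δ₀)) ≤ δ ^ 2 / (2 * (1 + δ)) := by
    rw [div_le_div_iff₀ (by positivity) (by positivity)]
    nlinarith [mul_nonneg (sub_nonneg.2 hδ) (mul_pos hδp hδ₀p).le,
      mul_nonneg (sub_nonneg.2 hδ) (add_pos hδp hδ₀p).le]
  have h3 : b ≤ n * (δ₀ ^ 2 / (2 * (1 + δ₀))) := by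
    rw [← mul_div_assoc, le_div_iff₀ (by positivity)]
    have h4 := H.n_mul_sq b
    rw [← hδ₀] at h4
    rw [h4]
    -- For `δ₀ ≤ 1` the rate is at least `nδ₀^2/4 = b^2/(4γ)`; for `δ₀ ≥ 1` it is at least `nδ₀/4`,
    -- and `n ≥ 4h^2`.
    rcases le_total δ₀ 1 with h5 | h5
    · have : 4 * b ≤ b ^ 2 / γ := by rw [le_div_iff₀ hγ]; nlinarith
      nlinarith
    · have h6 : 4 * b ≤ n * δ₀ := by
        rw [hδ₀, ← mul_div_assoc, le_div_iff₀ hh]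
        have h7 : 4 * h ^ 2 ≤ n := by
          have h8 : γ * (4 * h ^ 2) ≤ γ * n := by
            have h9 : 4 * γ ≤ h ^ 2 := by nlinarith [H.sq_le, H.one_le]
            rw [← H.h_pow]; nlinarith
          exact le_of_mul_le_mul_left h8 hγ
        nlinarith
      rw [← h4]
      nlinarith
  have h4 : 1 + δ - 1 - log (1 + δ) = δ - log (1 + δ) := by ring
  rw [h4]
  exact h3.trans (mul_le_mul_of_nonneg_left (h2.trans h1) hn.le)

/-- The constant 32 in `EdgeRegime.small` is the product of this 8 and the cutoff factor 4. -/
lemma δ₀_le (H : EdgeRegime n γ h ε) {b : ℝ} (hb : b ≤ 4 * γ) :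
    b / h ^ 2 * (8 * γ) ≤ ε := by
  have hh : 0 < h ^ 2 := pow_pos H.h_pos 2
  rw [div_mul_eq_mul_div, div_le_iff₀ hh]
  have := H.small
  nlinarith [H.γ_pos]

lemma δ₀_le_eighth (H : EdgeRegime n γ h ε) {b : ℝ} (hb0 : 0 ≤ b) (hb : b ≤ 4 * γ) :
    b / h ^ 2 ≤ 1 / 8 := by
  have h1 := H.δ₀_le hb
  have h2 := H.ε_le
  have h3 := H.one_le
  have : 0 ≤ b / h ^ 2 := by positivity
  nlinarith

/-- With `δ₀ = b/h^2` the quadratic term `nδ₀^2/2` is exactly `b^2/(2γ)`. All corrections are cubic,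
and `nδ₀^3 ≤ 16γδ₀ ≤ 2ε` below the cutoff. -/
lemma abs_exponent_le (H : EdgeRegime n γ h ε) {b δ : ℝ} (hb0 : 0 ≤ b) (hb : b ≤ 4 * γ)
    (hδ : b / h ^ 2 ≤ δ) (hδ' : δ ≤ b / h ^ 2 * (1 + b / h ^ 2 / 4)) :
    |n * (δ - log (1 + δ)) - b ^ 2 / (2 * γ)| ≤ ε := by
  have hγ := H.γ_pos
  have hn := H.n_pos'
  have h4 := H.n_mul_sq b
  have h5 := H.δ₀_le hb
  have h6 := H.δ₀_le_eighth hb0 hb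
  set δ₀ := b / h ^ 2 with hδ₀
  have hδ₀p : 0 ≤ δ₀ := by positivity
  have hδp : 0 ≤ δ := hδ₀p.trans hδ
  have h7 : n * δ₀ ^ 2 * δ₀ ≤ 2 * ε := by
    rw [h4]
    have : b ^ 2 / γ ≤ 16 * γ := by rw [div_le_iff₀ hγ]; nlinarith
    calc b ^ 2 / γ * δ₀ ≤ 16 * γ * δ₀ := by gcongr
      _ ≤ 2 * ε := by linarith
  have h8 : b ^ 2 / (2 * γ) = n * δ₀ ^ 2 / 2 := by rw [h4]; field_simp
  rw [h8, abs_le]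
  constructor
  · have h1 := le_sub_log hδp
    have h2 : δ₀ ^ 2 / (2 * (1 + δ₀)) ≤ δ ^ 2 / (2 * (1 + δ)) := by
      rw [div_le_div_iff₀ (by positivity) (by positivity)]
      nlinarith [mul_nonneg (sub_nonneg.2 hδ) (mul_nonneg hδp hδ₀p),
        mul_nonneg (sub_nonneg.2 hδ) (add_nonneg hδp hδ₀p)]
    have h3 : δ₀ ^ 2 / 2 - δ₀ ^ 2 * δ₀ / 2 ≤ δ₀ ^ 2 / (2 * (1 + δ₀)) := by
      rw [le_div_iff₀ (by positivity)]
      nlinarith [pow_nonneg hδ₀p 4]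
    have := mul_le_mul_of_nonneg_left (h3.trans (h2.trans h1)) hn.le
    nlinarith
  · have h1 := sub_log_le hδp
    have h2 : δ ^ 2 ≤ δ₀ ^ 2 * (1 + δ₀) := by
      calc δ ^ 2 ≤ (δ₀ * (1 + δ₀ / 4)) ^ 2 := by gcongr
        _ = δ₀ ^ 2 * (1 + δ₀ / 4) ^ 2 := by ring
        _ ≤ _ := by gcongr; nlinarith
    have := mul_le_mul_of_nonneg_left h1 hn.le
    have := mul_le_mul_of_nonneg_left h2 hn.le
    nlinarith

/-- A uniform upper bound for the large deviation weight. -/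
lemma ldWeight_le (H : EdgeRegime n γ h ε) {b δ : ℝ} (hb0 : 0 ≤ b)
    (hδ : b / h ^ 2 ≤ δ) (hδ' : δ ≤ b / h ^ 2 * (1 + b / h ^ 2 / 4)) :
    ldWeight n (1 + δ) ≤ 3 * exp (γ / 2 - b) := by
  have hγ := H.γ_pos
  have hδp : 0 ≤ δ := le_trans (by positivity) hδ
  rcases le_total b (4 * γ) with hb | hb
  · have h1 := (abs_le.1 (H.abs_exponent_le hb0 hb hδ hδ')).1
    have h2 := H.ε_le
    rw [ldWeight_eq_exp n (by positivity)]
    -- The tangent line at `b = γ`; with `b = γ + v` it yields the decay `exp (-γ/2 - v)`.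
    have h3 : b - γ / 2 ≤ b ^ 2 / (2 * γ) := by
      rw [le_div_iff₀ (by positivity)]; nlinarith [sq_nonneg (b - γ)]
    have h4 : 1 + δ - 1 - log (1 + δ) = δ - log (1 + δ) := by ring
    rw [h4]
    calc exp (-(n * (δ - log (1 + δ)))) ≤ exp (1 + (γ / 2 - b)) := exp_le_exp.2 (by linarith)
      _ = exp 1 * exp (γ / 2 - b) := exp_add _ _
      _ ≤ _ := by gcongr; linarith [exp_one_lt_d9]
  · refine (H.ldWeight_le_of_far hb hδ).trans ?_
    have : exp (-b) ≤ exp (γ / 2 - b) := exp_le_exp.2 (by linarith)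
    linarith [exp_pos (γ / 2 - b)]

end EdgeRegime

/-- Replace the factors by 1 one at a time; the weights 6 and 3 bound the factors still present. -/
lemma abs_mul_sub_one_le {c p w r e : ℝ} (hc : 1 ≤ c) (hc' : c ≤ 1 + e) 
    (hp : 0 ≤ p) (hp' : p ≤ 2) (hw : 0 ≤ w) (hw' : w ≤ 3) (hr : 0 ≤ r) (hr' : r ≤ 1) :
    |c * p * w * r - 1| ≤ 6 * e + 3 * |p - 1| + |w - 1| + (1 - r) := by
  have h1 : c * p * w * r - 1
      = (c - 1) * (p * w * r) + (p - 1) * (w * r) + (w - 1) * r + (r - 1) := by ring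
  rw [h1]
  have hpwr : p * w * r ≤ 6 := by
    calc p * w * r ≤ 2 * 3 * 1 := by gcongr
      _ = 6 := by norm_num
  have hwr : w * r ≤ 3 := by
    calc w * r ≤ 3 * 1 := by gcongr
      _ = 3 := by norm_num
  have a1 : |(c - 1) * (p * w * r)| ≤ 6 * e := by
    rw [abs_of_nonneg (mul_nonneg (by linarith) (by positivity))]
    calc (c - 1) * (p * w * r) ≤ e * 6 := by
          gcongr
          · linarith
          · linarith
      _ = _ := by ring
  have a2 : |(p - 1) * (w * r)| ≤ 3 * |p - 1| := by
    rw [abs_mul, abs_of_nonneg (mul_nonneg hw hr), mul_comm]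
    gcongr
  have a3 : |(w - 1) * r| ≤ |w - 1| := by
    rw [abs_mul, abs_of_nonneg hr]
    exact mul_le_of_le_one_right (abs_nonneg _) hr'
  have a4 : |r - 1| = 1 - r := by rw [abs_of_nonpos (by linarith)]; ring
  calc _ ≤ |(c - 1) * (p * w * r)| + |(p - 1) * (w * r)| + |(w - 1) * r| + |r - 1| :=
        (abs_add_le _ _).trans (add_le_add (abs_add_three _ _ _) le_rfl)
    _ ≤ _ := by rw [a4]; gcongr

lemma one_sub_mul_le {p q : ℝ} (hp' : p ≤ 1) (hq : q ≤ 1) :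
    1 - p * q ≤ (1 - p) + (1 - q) := by nlinarith

lemma abs_div_add_sub_one_le {γ v : ℝ} (hγ : 0 < γ) (hv : -(γ / 2) ≤ v) :
    |γ / (γ + v) - 1| ≤ (1 + v ^ 2) / γ := by
  have hb : 0 < γ + v := by linarith
  have h1 : γ / (γ + v) - 1 = -v / (γ + v) := by
    rw [eq_div_iff hb.ne', sub_mul, div_mul_cancel₀ _ hb.ne']; ring
  rw [h1, abs_div, abs_neg, abs_of_pos hb, div_le_div_iff₀ hb hγ]
  have h2 : 2 * |v| ≤ 1 + v ^ 2 := by nlinarith [sq_nonneg (|v| - 1), sq_abs v]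
  have h3 : 0 ≤ (1 + v ^ 2) * (v + γ / 2) := mul_nonneg (by positivity) (by linarith)
  nlinarith

lemma one_add_div_mul_sq_le {n δ₀ δ : ℝ} (hn : 0 < n) (h₀ : 0 < δ₀) (hδ : δ₀ ≤ δ) :
    (1 + δ) / (n * δ ^ 2) ≤ (1 + δ₀) / (n * δ₀ ^ 2) := by
  have hδp : 0 < δ := h₀.trans_le hδ
  rw [div_le_div_iff₀ (by positivity) (by positivity)]
  have : (1 + δ) * δ₀ ^ 2 ≤ (1 + δ₀) * δ ^ 2 := by
    nlinarith [mul_nonneg (sub_nonneg.2 hδ) (mul_pos hδp h₀).le,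
      mul_nonneg (sub_nonneg.2 hδ) (add_pos hδp h₀).le]
  nlinarith

/-- The normalizing ratio `√n e ^ (-γ / 2) / (2 √2 π h γ)`. -/
def normRatio (n : ℕ) (γ h : ℝ) : ℝ := √n * exp (-(γ / 2)) / (2 * √2 * π * h * γ)

/-- The rescaled trace density, in terms of `y` and `δ = |z| ^ 2 - 1`. -/
def edgeDensity (n : ℕ) (h y δ : ℝ) : ℝ :=
  n / (π * h ^ 3) * (√π * (√(2 * n) * (y / h)) * erfcx (√(2 * n) * (y / h))) * poissonTail n (1 + δ)

-- The density factors as `2 exp (-v)/√π` times `c p w r`. Here `c` is the normalization, `p = γ/b`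
-- comes from `1/δ`, `w` is the large deviation weight over its limit, and `r` collects four factors
-- in `[0,1]`: the `erfc` correction, the Abel defect, the Stirling defect, and `δ₀/δ`.
set_option maxHeartbeats 1600000 in
lemma EdgeRegime.abs_edgeDensity_sub_le {n : ℕ} {γ h ε e : ℝ} (H : EdgeRegime n γ h ε)
    (hc : 1 ≤ normRatio n γ h) (hc' : normRatio n γ h ≤ 1 + e) (he : e ≤ 1)
    {v y δ : ℝ} (hy : 0 < y) (hv : -(γ / 2) ≤ v)
    (hδ : (γ + v) / h ^ 2 ≤ δ) (hδ' : δ ≤ (γ + v) / h ^ 2 * (1 + (γ + v) / h ^ 2 / 4)) :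
    |edgeDensity n h y δ - 2 * (exp (-v) / √π)| ≤ 2 * (exp (-v) / √π)
      * ((√(2 * n) * (y / h)) ^ (-(1 / 2) : ℝ) + (6 * e + 2 * ε + 13 * (1 + v ^ 2) / γ)) := by
  have hγ := H.γ_pos
  have hγ1 := H.one_le
  have hn := H.n_pos'
  have hh := H.h_pos
  have hε := H.ε_pos
  have hε1 := H.ε_le
  set b := γ + v with hbdef
  have hb0 : γ / 2 ≤ b := by linarith
  have hb : 0 < b := by linarith
  set s := √(2 * n) * (y / h)
  have hs : 0 < s := by positivity
  set δ₀ := b / h ^ 2 with hδ₀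
  have hδ₀p : 0 < δ₀ := by positivity
  have hδp : 0 < δ := hδ₀p.trans_le hδ
  set c := normRatio n γ h with hcdef
  set E := √π * s * erfcx s with hE
  have hE0 : 0 ≤ E := by have := erfcx_nonneg s; positivity
  have hE1 : E ≤ 1 := mul_erfcx_le_one hs
  have hE2 : 1 - E ≤ s ^ (-(1 / 2) : ℝ) := one_sub_mul_erfcx_le_rpow hs
  set Φ := ldWeight n (1 + δ) with hΦ
  have hΦ0 : 0 < Φ := by rw [hΦ, ldWeight_eq_exp n (by positivity)]; exact exp_pos _
  set β := poissonPeak n with hβ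
  have hβ0 : 0 < β := by
    have : 0 < coef n n := by unfold coef; positivity
    exact mul_pos (exp_pos _) this
  set Q := poissonTail n (1 + δ) with hQ
  have hQ0 : 0 ≤ Q := poissonTail_nonneg n (by positivity)
  set p₂ := Q / (β * Φ / δ) with hp₂
  have hB : 0 < β * Φ / δ := by positivity
  have hp20 : 0 ≤ p₂ := by positivity
  have hp21 : p₂ ≤ 1 := by
    rw [hp₂, div_le_one hB]
    have := poissonTail_le n (u := 1 + δ) (by linarith)
    simpa using this
  set p₃ := β * √(2 * π * n) with hp₃
  have hp30 : 0 ≤ p₃ := by positivity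
  have hp31 : p₃ ≤ 1 := poissonPeak_mul_sqrt_le H.n_pos
  set p₄ := δ₀ / δ with hp₄
  have hp40 : 0 ≤ p₄ := by positivity
  have hp41 : p₄ ≤ 1 := by rw [hp₄, div_le_one hδp]; exact hδ
  set r := E * (p₂ * (p₃ * p₄)) with hr
  have hp34 : p₃ * p₄ ≤ 1 := mul_le_one₀ hp31 hp40 hp41
  have hp234 : p₂ * (p₃ * p₄) ≤ 1 := mul_le_one₀ hp21 (by positivity) hp34
  have hr0 : 0 ≤ r := by positivity
  have hr1 : r ≤ 1 := mul_le_one₀ hE1 (by positivity) hp234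
  set w := Φ * exp (γ / 2 + v) with hw
  have hw0 : 0 ≤ w := by positivity
  set p := γ / b with hp
  have hp0 : 0 ≤ p := by positivity
  have hp2 : p ≤ 2 := by rw [hp, div_le_iff₀ hb]; linarith
  set G := 2 * (exp (-v) / √π) with hG
  have hG0 : 0 < G := by positivity
  have hF : edgeDensity n h y δ = G * (c * p * w * r) := by
    have e1 : edgeDensity n h y δ = n / (π * h ^ 3) * E * Q := rfl
    have e2 : Q = p₂ * (β * Φ / δ) := by rw [hp₂, div_mul_cancel₀ _ hB.ne']
    have e3 : β = p₃ / √(2 * π * n) := by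
      rw [hp₃, mul_div_assoc, div_self (by positivity), mul_one]
    have e4 : 1 / δ = p₄ * h ^ 2 / b := by rw [hp₄, hδ₀]; field_simp
    have e5 : G * (c * p * w * r)
        = E * p₂ * p₃ * p₄ * Φ * (G * c * p * exp (γ / 2 + v)) := by rw [hw, hr]; ring
    have e6 : exp (-v) * exp (-(γ / 2)) * exp (γ / 2 + v) = 1 := by
      rw [← exp_add, ← exp_add]; simp
    have e7 : G * c * p * exp (γ / 2 + v) = √n / (√2 * √π * π * h * b) := by
      calc G * c * p * exp (γ / 2 + v)
          = (exp (-v) * exp (-(γ / 2)) * exp (γ / 2 + v)) * (2 / √π)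
            * (√n / (2 * √2 * π * h * γ)) * (γ / b) := by
            rw [hG, hcdef, hp, normRatio]; ring
        _ = _ := by rw [e6]; field_simp
    have e8 : n / √(2 * π * n) = √n / (√2 * √π) := by
      rw [sqrt_mul (by positivity), sqrt_mul two_pos.le]
      have : (n : ℝ) = √n * √n := (mul_self_sqrt hn.le).symm
      have h9 : 0 < √(n : ℝ) := by positivity
      nth_rw 1 [this]
      field_simp
    rw [e5, e7, e1, e2]
    calc n / (π * h ^ 3) * E * (p₂ * (β * Φ / δ))
        = n * β * (1 / δ) * (E * p₂ * Φ / (π * h ^ 3)) := by ring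
      _ = (n / √(2 * π * n)) * p₃ * (p₄ * h ^ 2 / b) * (E * p₂ * Φ / (π * h ^ 3)) := by
          rw [e4]; nth_rw 1 [e3]; ring
      _ = _ := by rw [e8]; field_simp
  have hmain : |c * p * w * r - 1|
      ≤ s ^ (-(1 / 2) : ℝ) + (6 * e + 2 * ε + 13 * (1 + v ^ 2) / γ) := by
    have hs2 : 0 ≤ s ^ (-(1 / 2) : ℝ) := by positivity
    clear hF hG0 hG hE
    clear_value G r w p p₄ p₃ p₂ Q β Φ E c δ₀ b
    have he0 : 0 ≤ e := by linarith
    -- Below the cutoff every factor is expanded around 1; above it boundedness suffices, since `v ≥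
    -- 3γ` makes the claimed error exceed 1.
    rcases le_total b (4 * γ) with hb4 | hb4
    · have hx := abs_le.1 (H.abs_exponent_le hb.le hb4 (hδ₀ ▸ hδ) (hδ₀ ▸ hδ'))
      set X := n * (δ - log (1 + δ)) - b ^ 2 / (2 * γ) with hX
      have hwX : w = exp (-(X + v ^ 2 / (2 * γ))) := by
        rw [hw, hΦ, ldWeight_eq_exp n (by positivity), ← exp_add, hX]
        congr 1
        rw [hbdef]; field_simp; ring
      have hv2 : 0 ≤ v ^ 2 / (2 * γ) := by positivity
      have hwu : w ≤ 1 + 2 * ε := by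
        have h1 : w ≤ exp ε := by rw [hwX]; exact exp_le_exp.2 (by linarith)
        have h2 := abs_exp_sub_one_le (x := ε) (by rw [abs_of_pos hε]; exact hε1)
        rw [abs_of_pos hε] at h2
        linarith [le_abs_self (exp ε - 1)]
      have hwl : 1 - (ε + v ^ 2 / (2 * γ)) ≤ w := by
        rw [hwX]
        linarith [add_one_le_exp (-(X + v ^ 2 / (2 * γ)))]
      have hw1 : |w - 1| ≤ 2 * ε + v ^ 2 / (2 * γ) := by
        rw [abs_le]; constructor <;> linarith
      have hp1 : |p - 1| ≤ (1 + v ^ 2) / γ := by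
        rw [hp, hbdef]
        exact abs_div_add_sub_one_le hγ hv
      have hδ8 := H.δ₀_le_eighth hb.le hb4
      have hδε := H.δ₀_le hb4
      rw [← hδ₀] at hδ8 hδε
      -- The Abel defect is at most `(1+δ₀)/(nδ₀^2) = (1+δ₀)γ/b^2`, with `b ≥ γ/2` and `δ₀ ≤ 1`.
      have hp22 : 1 - p₂ ≤ 8 / γ := by
        have h1 := le_poissonTail H.n_pos (u := 1 + δ) (by linarith)
        have h2 : 1 - (1 + δ) / (n * δ ^ 2) ≤ p₂ := by
          rw [← hβ, ← hΦ, ← hQ, add_sub_cancel_left] at h1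
          rw [hp₂, le_div_iff₀ hB, mul_comm]
          exact h1
        have h3 := one_add_div_mul_sq_le hn hδ₀p hδ
        have h4 : (1 + δ₀) / (n * δ₀ ^ 2) ≤ 8 / γ := by
          rw [hδ₀, H.n_mul_sq b, ← hδ₀, div_div_eq_mul_div, div_le_div_iff₀ (by positivity) hγ]
          have g1 : (γ / 2) ^ 2 ≤ b ^ 2 := pow_le_pow_left₀ (by positivity) hb0 2
          have g2 : δ₀ * γ ^ 2 ≤ 1 * γ ^ 2 :=
            mul_le_mul_of_nonneg_right (by linarith) (sq_nonneg γ)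
          linarith
        linarith
      have hp32 : 1 - p₃ ≤ 1 / γ := by
        have h1 := le_poissonPeak_mul_sqrt H.n_pos
        have h2 : 1 / (12 * (n : ℝ)) ≤ 1 / γ :=
          one_div_le_one_div_of_le hγ (by linarith [H.γ_le])
        rw [hp₃, hβ]
        linarith
      have hp42 : 1 - p₄ ≤ 1 / γ := by
        have h1 : 1 - δ₀ ≤ p₄ := by
          rw [hp₄, le_div_iff₀ hδp]
          have g1 := mul_le_mul_of_nonneg_left hδ' (by linarith : 0 ≤ 1 - δ₀)
          have g2 := pow_pos hδ₀p 2
          have g3 := pow_pos hδ₀p 3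
          linarith
        have h2 : δ₀ ≤ 1 / γ := by
          rw [le_div_iff₀ hγ]; linarith [mul_nonneg hδ₀p.le hγ.le]
        linarith
      have hr2 : 1 - r ≤ s ^ (-(1 / 2) : ℝ) + 10 / γ := by
        have h1 := one_sub_mul_le hE1 hp234
        have h2 := one_sub_mul_le hp21 hp34
        have h3 := one_sub_mul_le hp31 hp41
        have h4 : (10 : ℝ) / γ = 8 / γ + 1 / γ + 1 / γ := by ring
        linarith
      refine (abs_mul_sub_one_le hc hc' hp0 hp2 hw0 (by linarith) hr0 hr1).trans ?_
      -- The 13 is 3 from `p` plus 10 from `r`; the surplus in `v^2` covers the quadratic error of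
      -- `w`.
      have h5 : (13 : ℝ) * (1 + v ^ 2) / γ
          = 3 * ((1 + v ^ 2) / γ) + 10 / γ + 20 * (v ^ 2 / (2 * γ)) := by field_simp; ring
      rw [h5]
      linarith
    · have hw1 : w ≤ 1 := by
        have h1 := H.ldWeight_le_of_far hb4 (hδ₀ ▸ hδ)
        rw [← hΦ] at h1
        calc w ≤ exp (-b) * exp (γ / 2 + v) := by rw [hw]; gcongr
          _ = exp (-(γ / 2)) := by rw [← exp_add]; congr 1; rw [hbdef]; ring
          _ ≤ 1 := exp_le_one_iff.2 (by linarith)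
      have hp1 : p ≤ 1 := by rw [hp, div_le_one hb]; linarith
      have h0 : 0 ≤ c * p * w * r := by positivity
      have h2 : c * p * w * r ≤ 2 * 1 * 1 * 1 := by gcongr; linarith
      have h3 : |c * p * w * r - 1| ≤ 1 := by rw [abs_le]; constructor <;> linarith
      have h4 : 1 ≤ 13 * (1 + v ^ 2) / γ := by
        rw [le_div_iff₀ hγ]
        have g1 : (3 * γ) ^ 2 ≤ v ^ 2 := pow_le_pow_left₀ (by positivity) (by linarith) 2
        have g2 : γ * 1 ≤ γ * γ := mul_le_mul_of_nonneg_left hγ1 hγ.le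
        linarith
      linarith
  have h1 : edgeDensity n h y δ - G = G * (c * p * w * r - 1) := by rw [hF]; ring
  rw [h1, abs_mul, abs_of_pos hG0]
  gcongr

/-! ### Rescaled coordinates -/

/-- The fourth root `(γ n) ^ (1 / 4)`. -/
def hscale (n : ℕ) : ℝ := (scale n * n) ^ (1 / 4 : ℝ)

/-- The excess `|z| ^ 2 - 1` in rescaled coordinates. -/
def excess (γ h x y : ℝ) : ℝ := (γ + x + y ^ 2) / h ^ 2 + (γ + x) ^ 2 / (4 * h ^ 4)

lemma hscale_pow {n : ℕ} (hγ : 0 < scale n) : hscale n ^ 4 = scale n * n := by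
  unfold hscale
  rw [← rpow_natCast, ← rpow_mul (by positivity)]
  norm_num

lemma hscale_pos {n : ℕ} (hn : 0 < n) (hγ : 0 < scale n) : 0 < hscale n := by
  have : (0 : ℝ) < n := by exact_mod_cast hn
  unfold hscale; positivity

lemma sqrt_four_mul {n : ℕ} (hγ : 0 < scale n) : √(4 * scale n * n) = 2 * hscale n ^ 2 := by
  have : 4 * scale n * n = (2 * hscale n ^ 2) ^ 2 := by
    rw [mul_pow, ← pow_mul, hscale_pow hγ]; ring
  rw [this, sqrt_sq (by positivity)]

lemma sqrt_scale_div {n : ℕ} (hn : 0 < n) (hγ : 0 < scale n) :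
    √(scale n / (4 * n)) = scale n / (2 * hscale n ^ 2) := by
  have hn' : (0 : ℝ) < n := by exact_mod_cast hn
  have : scale n / (4 * n) = (scale n / (2 * hscale n ^ 2)) ^ 2 := by
    rw [div_pow, mul_pow, ← pow_mul, hscale_pow hγ]; field_simp; norm_num
  rw [this, sqrt_sq (by positivity)]

lemma point_re {n : ℕ} (hn : 0 < n) (hγ : 0 < scale n) (x y : ℝ) :
    (point n x y).re = 1 + scale n / (2 * hscale n ^ 2) + x / (2 * hscale n ^ 2) := by
  unfold point
  rw [sqrt_four_mul hγ, sqrt_scale_div hn hγ, Complex.add_re, Complex.ofReal_re, Complex.I_mul_re,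
    Complex.ofReal_im]
  ring

lemma point_im (n : ℕ) (x y : ℝ) : (point n x y).im = y / hscale n := by
  unfold point hscale
  rw [Complex.add_im, Complex.ofReal_im, Complex.I_mul_im, Complex.ofReal_re, zero_add]

lemma norm_point_sq {n : ℕ} (hn : 0 < n) (hγ : 0 < scale n) (x y : ℝ) :
    ‖point n x y‖ ^ 2 = 1 + excess (scale n) (hscale n) x y := by
  have := hscale_pos hn hγ
  rw [Complex.sq_norm, Complex.normSq_apply, point_re hn hγ, point_im, excess]
  field_simp
  ring

lemma point_mem_region {n : ℕ} (hn : 0 < n) (hγ : 0 < scale n) {t x y : ℝ} :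
    point n x y ∈ region n t ↔ t ≤ x := by
  have := hscale_pos hn hγ
  unfold region
  rw [mem_ofPred_eq, point_re hn hγ, sqrt_four_mul hγ, sqrt_scale_div hn hγ, add_le_add_iff_left,
    div_le_div_iff_of_pos_right (by positivity)]

lemma point_mem_upper {n : ℕ} (hn : 0 < n) (hγ : 0 < scale n) {x y : ℝ} :
    point n x y ∈ upper ↔ 0 ≤ y := by
  have := hscale_pos hn hγ
  unfold upper
  rw [mem_ofPred_eq, point_im]
  constructor
  · intro h
    by_contra! hy
    exact absurd h (not_le.2 (div_neg_of_neg_of_pos hy this))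
  · intro h; positivity

lemma measurable_point (n : ℕ) : Measurable fun p : ℝ × ℝ => point n p.1 p.2 := by
  unfold point; fun_prop

lemma measurableSet_upper : MeasurableSet upper :=
  measurableSet_le measurable_const Complex.measurable_im

lemma measurableSet_region (n : ℕ) (t : ℝ) : MeasurableSet (region n t) :=
  measurableSet_le measurable_const Complex.measurable_re

/-- Lebesgue measure on the quadrant `(t, ∞) × (0, ∞)`. -/
def quadrant (t : ℝ) : Measure (ℝ × ℝ) :=
  (volume.restrict (Ioi t)).prod (volume.restrict (Ioi 0))

lemma map_affine {a : ℝ} (b : ℝ) (ha : 0 < a) :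
    Measure.map (fun x => b + x / a) volume = ENNReal.ofReal a • (volume : Measure ℝ) := by
  have h1 : (fun x => b + x / a) = (fun x => b + x) ∘ fun x => a⁻¹ * x := by
    ext x; simp [div_eq_inv_mul]
  rw [h1, ← Measure.map_map (by fun_prop) (by fun_prop),
    Real.map_volume_mul_left (inv_ne_zero ha.ne'), Measure.map_smul, map_add_left_eq_self, inv_inv,
    abs_of_pos ha]

/-- The real direction is compressed by `2h^2` and the imaginary one by `h`, so the inverse Jacobian
is `2h^3`. -/
lemma map_point {n : ℕ} (hn : 0 < n) (hγ : 0 < scale n) :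
    Measure.map (fun p : ℝ × ℝ => point n p.1 p.2) volume
      = ENNReal.ofReal (2 * hscale n ^ 3) • (volume : Measure ℂ) := by
  have hh := hscale_pos hn hγ
  set f : ℝ → ℝ := fun x => (1 + scale n / (2 * hscale n ^ 2)) + x / (2 * hscale n ^ 2)
  set k : ℝ → ℝ := fun y => 0 + y / hscale n
  have h1 : (fun p : ℝ × ℝ => point n p.1 p.2)
      = Complex.measurableEquivRealProd.symm ∘ Prod.map f k := by
    ext p
    apply Complex.ext
    · simp [point_re hn hγ, f]
    · simp [point_im, k]
  have h2 : (volume : Measure ℂ) = Measure.map Complex.measurableEquivRealProd.symm volume :=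
    Complex.volume_preserving_equiv_real_prod.symm.map_eq.symm
  have hf : Measurable f := by fun_prop
  have hk : Measurable k := by fun_prop
  rw [h1, ← Measure.map_map (by fun_prop) (hf.prodMap hk), h2, Measure.volume_eq_prod,
    ← Measure.map_prod_map _ _ hf hk, map_affine _ (by positivity), map_affine _ hh,
    Measure.prod_smul_left, Measure.prod_smul_right, smul_smul, Measure.map_smul,
    ← ENNReal.ofReal_mul (by positivity)]
  congr 2; ring

lemma quadrant_eq (t : ℝ) : quadrant t = volume.restrict (Ici t ×ˢ Ici 0) := by
  unfold quadrant
  rw [Measure.prod_restrict, Measure.volume_eq_prod]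
  exact Measure.restrict_congr_set (Measure.set_prod_ae_eq Ioi_ae_eq_Ici Ioi_ae_eq_Ici)

lemma volume_restrict_eq {n : ℕ} (hn : 0 < n) (hγ : 0 < scale n) (t : ℝ) :
    (volume : Measure ℂ).restrict (upper ∩ region n t)
      = ENNReal.ofReal (1 / (2 * hscale n ^ 3))
        • Measure.map (fun p : ℝ × ℝ => point n p.1 p.2) (quadrant t) := by
  have hh := hscale_pos hn hγ
  have hR := measurableSet_upper.inter (measurableSet_region n t)
  have h1 : (volume : Measure ℂ) = ENNReal.ofReal (1 / (2 * hscale n ^ 3))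
      • Measure.map (fun p : ℝ × ℝ => point n p.1 p.2) volume := by
    rw [map_point hn hγ, smul_smul, ← ENNReal.ofReal_mul (by positivity),
      one_div_mul_cancel (by positivity)]
    simp
  have h2 : (fun p : ℝ × ℝ => point n p.1 p.2) ⁻¹' (upper ∩ region n t) = Ici t ×ˢ Ici 0 := by
    ext p
    simp only [mem_preimage, mem_inter_iff, point_mem_upper hn hγ, point_mem_region hn hγ,
      mem_prod, mem_Ici]
    tauto
  conv_lhs => rw [h1]
  rw [Measure.restrict_smul, Measure.restrict_map (measurable_point n) hR, quadrant_eq, h2]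

lemma setIntegral_upper_eq {n : ℕ} (hn : 0 < n) (hγ : 0 < scale n) {t : ℝ} {f : ℂ → ℝ}
    (hf : Measurable f) (hsupp : ∀ z ∉ region n t, f z = 0) :
    ∫ z in upper, f z = ∫ p, 1 / (2 * hscale n ^ 3) * f (point n p.1 p.2) ∂(quadrant t) := by
  have hh := hscale_pos hn hγ
  have h1 : ∫ z in upper, f z = ∫ z in upper ∩ region n t, f z := by
    exact setIntegral_eq_of_subset_of_forall_sdiff_eq_zero measurableSet_upper inter_subset_left
      fun z hz => hsupp z fun h => hz.2 ⟨hz.1, h⟩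
  rw [h1, volume_restrict_eq hn hγ, integral_smul_measure,
    integral_map (measurable_point n).aemeasurable hf.aestronglyMeasurable, integral_const_mul,
    ENNReal.toReal_ofReal (by positivity), smul_eq_mul]

/-- An inequality suffices for the Hilbert-Schmidt norm and requires no measurability of the
integrand. -/
lemma setLIntegral_upper_le {n : ℕ} (hn : 0 < n) (hγ : 0 < scale n) {t : ℝ} {f : ℂ → ENNReal}
    (hsupp : ∀ z ∉ region n t, f z = 0) :
    ∫⁻ z in upper, f z
      ≤ ENNReal.ofReal (1 / (2 * hscale n ^ 3)) * ∫⁻ p, f (point n p.1 p.2) ∂(quadrant t) := by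
  have h1 : ∫⁻ z in upper, f z = ∫⁻ z in upper ∩ region n t, f z := by
    rw [inter_comm, ← Measure.restrict_restrict (measurableSet_region n t)]
    refine (setLIntegral_eq_of_support_subset fun z hz => ?_).symm
    by_contra h
    exact hz (hsupp z h)
  rw [h1, volume_restrict_eq hn hγ, lintegral_smul_measure, smul_eq_mul]
  gcongr
  exact lintegral_map_le _ _

/-! ### The trace -/

/-- The trace of the matrix kernel on the diagonal of the upper half-plane. -/
def traceDensity (n : ℕ) (z : ℂ) : ℝ :=
  2 * (n / π * (√π * (√(2 * n) * z.im) * erfcx (√(2 * n) * z.im)) * poissonTail n (‖z‖ ^ 2))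

lemma measurable_truncExp (n m : ℕ) : Measurable (truncExp n m) := by
  unfold truncExp; fun_prop

lemma measurable_poissonTail (n : ℕ) : Measurable (poissonTail n) := by
  have := measurable_truncExp n n
  unfold poissonTail; fun_prop

lemma measurable_traceDensity (n : ℕ) : Measurable (traceDensity n) := by
  have h1 := measurable_poissonTail n
  have h2 := measurable_erfcx
  have h3 : Measurable Complex.im := Complex.measurable_im
  unfold traceDensity; fun_prop

lemma traceDensity_nonneg (n : ℕ) {z : ℂ} (hz : 0 ≤ z.im) : 0 ≤ traceDensity n z := by
  have := erfcx_nonneg (√(2 * n) * z.im)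
  have := poissonTail_nonneg n (sq_nonneg ‖z‖)
  unfold traceDensity; positivity

lemma trace_sandwich {g : ℂ → ℝ} (hg : ∀ z, 0 ≤ g z) (n : ℕ) {z : ℂ} (hz : z ∈ upper) :
    (sandwich g (matrixKernel n) z z).trace = ((g z * traceDensity n z : ℝ) : ℂ) := by
  unfold sandwich matrixKernel
  rw [mul_self_sqrt (hg z), Matrix.trace_smul, Matrix.trace_fin_two]
  simp only [Matrix.of_apply, Matrix.cons_val', Matrix.cons_val_zero, Matrix.cons_val_one,
    Matrix.cons_val_fin_one]
  rw [scalarKernel_self n hz, traceDensity, smul_eq_mul]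
  push_cast; ring

lemma opTrace_sandwich {g : ℂ → ℝ} (hg : ∀ z, 0 ≤ g z) (n : ℕ) :
    opTrace (sandwich g (matrixKernel n)) = ((∫ z in upper, g z * traceDensity n z : ℝ) : ℂ) := by
  unfold opTrace
  rw [← integral_complex_ofReal]
  exact setIntegral_congr_fun measurableSet_upper fun z hz => trace_sandwich hg n hz

lemma traceDensity_point {n : ℕ} (hn : 0 < n) (hγ : 0 < scale n) (x y : ℝ) :
    1 / (2 * hscale n ^ 3) * traceDensity n (point n x y)
      = edgeDensity n (hscale n) y (excess (scale n) (hscale n) x y) := by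
  have := hscale_pos hn hγ
  unfold traceDensity edgeDensity
  rw [norm_point_sq hn hγ, point_im]
  field_simp

/-! ### Moments -/

lemma integrableOn_exp_neg_Ioi (t : ℝ) : IntegrableOn (fun x : ℝ => exp (-x)) (Ioi t) :=
  by simpa using exp_neg_integrableOn_Ioi t one_pos

lemma integral_sq_mul_exp_neg (t : ℝ) :
    IntegrableOn (fun x : ℝ => x ^ 2 * exp (-x)) (Ioi t) ∧
    ∫ x in Ioi t, x ^ 2 * exp (-x) = (t ^ 2 + 2 * t + 2) * exp (-t) := by
  have hd : ∀ x ∈ Ici t, HasDerivAt (fun x : ℝ => -((x ^ 2 + 2 * x + 2) * exp (-x)))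
      (x ^ 2 * exp (-x)) x := by
    intro x _
    have h1 : HasDerivAt (fun x : ℝ => exp (-x)) (exp (-x) * (-1)) x := (hasDerivAt_neg x).exp
    have h2 : HasDerivAt (fun x : ℝ => x ^ 2 + 2 * x + 2) (2 * x + 2) x := by
      simpa using ((hasDerivAt_pow 2 x).add ((hasDerivAt_id x).const_mul 2)).add_const 2
    convert! (h2.mul h1).neg using 1
    ring
  have hlim : Tendsto (fun x : ℝ => -((x ^ 2 + 2 * x + 2) * exp (-x))) atTop (𝓝 0) := by
    have a2 := tendsto_pow_mul_exp_neg_atTop_nhds_zero 2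
    have a1 := tendsto_pow_mul_exp_neg_atTop_nhds_zero 1
    have a0 := tendsto_pow_mul_exp_neg_atTop_nhds_zero 0
    have := ((a2.add (a1.const_mul 2)).add (a0.const_mul 2)).neg
    simp only [mul_zero, add_zero, neg_zero] at this
    refine this.congr fun x => ?_
    ring
  have hi := integrableOn_Ioi_deriv_of_nonneg' hd (fun x _ => by positivity) hlim
  refine ⟨hi, ?_⟩
  rw [integral_Ioi_of_hasDerivAt_of_tendsto' hd hi hlim]
  ring

lemma integrableOn_rpow_gaussian {s : ℝ} (hs : -1 < s) :
    IntegrableOn (fun y : ℝ => y ^ s * exp (-y ^ 2)) (Ioi 0) := by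
  simpa using integrableOn_rpow_mul_exp_neg_mul_sq one_pos hs

lemma integrableOn_pow_gaussian (k : ℕ) :
    IntegrableOn (fun y : ℝ => y ^ k * exp (-y ^ 2)) (Ioi 0) := by
  simpa using integrableOn_rpow_gaussian (s := k) (by linarith [k.cast_nonneg (α := ℝ)])

/-- The half-line Gaussian moment of order `-1 / 2`. -/
def halfMoment : ℝ := ∫ y in Ioi (0 : ℝ), y ^ (-(1 / 2) : ℝ) * exp (-y ^ 2)

/-- The half-line Gaussian moment of order `4`. -/
def fourthMoment : ℝ := ∫ y in Ioi (0 : ℝ), y ^ 4 * exp (-y ^ 2)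

lemma halfMoment_nonneg : 0 ≤ halfMoment :=
  setIntegral_nonneg measurableSet_Ioi fun y hy => by
    have : (0 : ℝ) < y := hy
    positivity

lemma fourthMoment_nonneg : 0 ≤ fourthMoment :=
  setIntegral_nonneg measurableSet_Ioi fun y _ => by positivity

lemma integral_gaussian_half : ∫ y in Ioi (0 : ℝ), exp (-y ^ 2) = √π / 2 := by
  simpa using integral_gaussian_Ioi 1

/-- The integrable majorant for the error of the edge density. -/
def edgeMajorant (κ A B : ℝ) (p : ℝ × ℝ) : ℝ :=
  2 / √π * (κ * (exp (-p.1) * (p.2 ^ (-(1 / 2) : ℝ) * exp (-p.2 ^ 2)))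
    + ((A + B) * (exp (-p.1) * exp (-p.2 ^ 2)) + (2 * B * (p.1 ^ 2 * exp (-p.1) * exp (-p.2 ^ 2))
      + 2 * B * (exp (-p.1) * (p.2 ^ 4 * exp (-p.2 ^ 2))))))

lemma integrable_quadrant_mul {t : ℝ} {f k : ℝ → ℝ} (hf : IntegrableOn f (Ioi t))
    (hk : IntegrableOn k (Ioi 0)) :
    Integrable (fun p : ℝ × ℝ => f p.1 * k p.2) (quadrant t) := Integrable.mul_prod hf hk

lemma integral_quadrant_mul (t : ℝ) (f k : ℝ → ℝ) :
    ∫ p, f p.1 * k p.2 ∂(quadrant t) = (∫ x in Ioi t, f x) * ∫ y in Ioi 0, k y :=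
  integral_prod_mul f k

lemma integral_edgeMajorant (t κ A B : ℝ) :
    Integrable (edgeMajorant κ A B) (quadrant t) ∧
    ∫ p, edgeMajorant κ A B p ∂(quadrant t) = 2 / √π * exp (-t) * (κ * halfMoment
      + (A + B) * (√π / 2) + 2 * B * (t ^ 2 + 2 * t + 2) * (√π / 2) + 2 * B * fourthMoment) := by
  have hx := integrableOn_exp_neg_Ioi t
  have hy : IntegrableOn (fun y : ℝ => exp (-y ^ 2)) (Ioi 0) := integrable_exp_neg_sq.integrableOn
  have i1 := (integrable_quadrant_mul hx
    (integrableOn_rpow_gaussian (s := -(1 / 2)) (by norm_num))).const_mul κ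
  have i2 := (integrable_quadrant_mul hx hy).const_mul (A + B)
  have i3 := (integrable_quadrant_mul (integral_sq_mul_exp_neg t).1 hy).const_mul (2 * B)
  have i4 := (integrable_quadrant_mul hx (integrableOn_pow_gaussian 4)).const_mul (2 * B)
  have i34 := i3.add i4
  have i234 := i2.add i34
  simp only [Pi.add_def] at i34 i234
  refine ⟨(i1.add i234).const_mul (2 / √π), ?_⟩
  unfold edgeMajorant
  rw [integral_const_mul, integral_add i1 i234, integral_add i2 i34, integral_add i3 i4]
  simp only [integral_const_mul]
  rw [integral_quadrant_mul t (fun x => exp (-x)) (fun y => y ^ (-(1 / 2) : ℝ) * exp (-y ^ 2)),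
    integral_quadrant_mul t (fun x => exp (-x)) (fun y => exp (-y ^ 2)),
    integral_quadrant_mul t (fun x => x ^ 2 * exp (-x)) (fun y => exp (-y ^ 2)),
    integral_quadrant_mul t (fun x => exp (-x)) (fun y => y ^ 4 * exp (-y ^ 2)),
    integral_exp_neg_Ioi, (integral_sq_mul_exp_neg t).2, integral_gaussian_half]
  unfold halfMoment fourthMoment
  ring

/-- The excess depends on `y` beyond `v = x + y^2`; enlarging `(γ+x)^2` to `(γ+x+y^2)^2` puts it
between two functions of `v` alone. -/
lemma excess_bounds {n : ℕ} {γ h ε x y : ℝ} (H : EdgeRegime n γ h ε) (hx : -(γ / 2) ≤ x) :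
    (γ + (x + y ^ 2)) / h ^ 2 ≤ excess γ h x y ∧
    excess γ h x y
      ≤ (γ + (x + y ^ 2)) / h ^ 2 * (1 + (γ + (x + y ^ 2)) / h ^ 2 / 4) := by
  have hh := H.h_pos
  have hγ := H.γ_pos
  have h1 : (γ + (x + y ^ 2)) / h ^ 2 * (1 + (γ + (x + y ^ 2)) / h ^ 2 / 4)
      = (γ + x + y ^ 2) / h ^ 2 + (γ + x + y ^ 2) ^ 2 / (4 * h ^ 4) := by field_simp; ring
  rw [h1, excess, ← add_assoc]
  refine ⟨le_add_of_nonneg_right (by positivity), ?_⟩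
  have h2 : 0 ≤ γ + x := by linarith
  have h3 : γ + x ≤ γ + x + y ^ 2 := by linarith [sq_nonneg y]
  have h4 : (γ + x) ^ 2 ≤ (γ + x + y ^ 2) ^ 2 := pow_le_pow_left₀ h2 h3 2
  gcongr

lemma ae_quadrant (t : ℝ) : ∀ᵐ p ∂(quadrant t), t < p.1 ∧ 0 < p.2 := by
  unfold quadrant
  rw [Measure.prod_restrict]
  exact ae_restrict_mem (measurableSet_Ioi.prod measurableSet_Ioi)

lemma abs_edgeDensity_sub_le_majorant {n : ℕ} {γ h ε e : ℝ} (H : EdgeRegime n γ h ε)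
    (hc : 1 ≤ normRatio n γ h) (hc' : normRatio n γ h ≤ 1 + e) (he : e ≤ 1)
    {x y : ℝ} (hx : -(γ / 2) ≤ x) (hy : 0 < y) :
    |edgeDensity n h y (excess γ h x y) - 2 * (exp (-x - y ^ 2) / √π)|
      ≤ edgeMajorant ((√(2 * n) / h) ^ (-(1 / 2) : ℝ)) (6 * e + 2 * ε) (13 / γ) (x, y) := by
  have hh := H.h_pos
  have hγ := H.γ_pos
  obtain ⟨h1, h2⟩ := excess_bounds (y := y) H hx
  have h3 := H.abs_edgeDensity_sub_le hc hc' he hy (v := x + y ^ 2) (by nlinarith) h1 h2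
  have h4 : -(x + y ^ 2) = -x - y ^ 2 := by ring
  have h5 : √(2 * n) * (y / h) = √(2 * n) / h * y := by ring
  rw [h4, h5, mul_rpow (by positivity) hy.le] at h3
  refine h3.trans ?_
  set κ := (√(2 * n) / h) ^ (-(1 / 2) : ℝ)
  have h6 : exp (-x - y ^ 2) = exp (-x) * exp (-y ^ 2) := by rw [← exp_add]; congr 1
  unfold edgeMajorant
  simp only
  have h7 : 13 * (1 + (x + y ^ 2) ^ 2) / γ ≤ 13 / γ * (1 + 2 * x ^ 2 + 2 * y ^ 4) := by
    rw [mul_div_right_comm]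
    refine mul_le_mul_of_nonneg_left ?_ (by positivity)
    nlinarith [sq_nonneg (x - y ^ 2)]
  calc 2 * (exp (-x - y ^ 2) / √π) * (κ * y ^ (-(1 / 2) : ℝ)
        + (6 * e + 2 * ε + 13 * (1 + (x + y ^ 2) ^ 2) / γ))
      ≤ 2 * (exp (-x - y ^ 2) / √π) * (κ * y ^ (-(1 / 2) : ℝ)
        + (6 * e + 2 * ε + 13 / γ * (1 + 2 * x ^ 2 + 2 * y ^ 4))) := by gcongr
    _ = _ := by rw [h6]; ring

lemma integral_limit_eq {n : ℕ} {t : ℝ} {g : ℂ → ℝ} (hgm : Measurable g)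
    (hg : ∀ z, 0 ≤ g z ∧ g z ≤ 1) :
    Integrable (fun p : ℝ × ℝ => g (point n p.1 p.2) * (exp (-p.1 - p.2 ^ 2) / √π)) (quadrant t) ∧
    ∫ x in Ioi t, ∫ y in Ioi (0 : ℝ), g (point n x y) * (exp (-x - y ^ 2) / √π)
      = ∫ p, g (point n p.1 p.2) * (exp (-p.1 - p.2 ^ 2) / √π) ∂(quadrant t) := by
  have hi : Integrable (fun p : ℝ × ℝ => g (point n p.1 p.2) * (exp (-p.1 - p.2 ^ 2) / √π))
      (quadrant t) := by
    have hd := (integrable_quadrant_mul (integrableOn_exp_neg_Ioi t)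
      (integrable_exp_neg_sq.integrableOn (s := Ioi 0))).div_const √π
    refine hd.mono' ?_ (Eventually.of_forall fun p => ?_)
    · have := hgm.comp (measurable_point n)
      exact (this.mul (by fun_prop)).aestronglyMeasurable
    · rw [norm_mul, norm_of_nonneg (hg _).1, norm_of_nonneg (by positivity), ← exp_add, sub_eq_add_neg]
      exact mul_le_of_le_one_left (by positivity) (hg _).2
  exact ⟨hi, (integral_prod _ hi).symm⟩

/-- As `0 ≤ g ≤ 1`, the pointwise error bound survives multiplication by `g`, and its integral is a
combination of explicit moments. -/
theorem abs_trace_sub_le {n : ℕ} {ε e t : ℝ} {g : ℂ → ℝ}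
    (H : EdgeRegime n (scale n) (hscale n) ε)
    (hc : 1 ≤ normRatio n (scale n) (hscale n)) (hc' : normRatio n (scale n) (hscale n) ≤ 1 + e)
    (he : e ≤ 1) (ht : -(scale n / 2) ≤ t) (hgm : Measurable g) (hg : ∀ z, 0 ≤ g z ∧ g z ≤ 1)
    (hsupp : Function.support g ⊆ region n t) :
    |(∫ z in upper, g z * traceDensity n z) - 2 * ∫ x in Ioi t, ∫ y in Ioi (0 : ℝ),
        g (point n x y) * (exp (-x - y ^ 2) / √π)|
      ≤ 2 / √π * exp (-t) * ((√(2 * n) / hscale n) ^ (-(1 / 2) : ℝ) * halfMoment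
        + (6 * e + 2 * ε + 13 / scale n) * (√π / 2)
        + 2 * (13 / scale n) * (t ^ 2 + 2 * t + 2) * (√π / 2)
        + 2 * (13 / scale n) * fourthMoment) := by
  obtain ⟨hi, hI⟩ := integral_limit_eq (n := n) (t := t) hgm hg
  have hn := H.n_pos
  have hγ := H.γ_pos
  obtain ⟨hM, hMI⟩ := integral_edgeMajorant t ((√(2 * n) / hscale n) ^ (-(1 / 2) : ℝ))
    (6 * e + 2 * ε) (13 / scale n)
  have h1 : ∫ z in upper, g z * traceDensity n z = ∫ p, g (point n p.1 p.2)
      * edgeDensity n (hscale n) p.2 (excess (scale n) (hscale n) p.1 p.2) ∂(quadrant t) := by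
    rw [setIntegral_upper_eq hn hγ (f := fun z => g z * traceDensity n z)
      (hgm.mul (measurable_traceDensity n)) (t := t)]
    · refine integral_congr_ae (Eventually.of_forall fun p => ?_)
      simp only
      rw [← traceDensity_point hn hγ]; ring
    · intro z hz
      have : g z = 0 := by
        by_contra h; exact hz (hsupp h)
      rw [this, zero_mul]
  have hmeas : Measurable fun p : ℝ × ℝ => g (point n p.1 p.2)
      * edgeDensity n (hscale n) p.2 (excess (scale n) (hscale n) p.1 p.2) := by
    have e1 := hgm.comp (measurable_point n)
    have e2 := (measurable_traceDensity n).comp (measurable_point n)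
    have e3 : (fun p : ℝ × ℝ => edgeDensity n (hscale n) p.2
        (excess (scale n) (hscale n) p.1 p.2)) = fun p => 1 / (2 * hscale n ^ 3)
          * traceDensity n (point n p.1 p.2) := by
      ext p; rw [traceDensity_point hn hγ]
    exact e1.mul (e3 ▸ e2.const_mul _)
  set F := fun p : ℝ × ℝ => g (point n p.1 p.2)
      * edgeDensity n (hscale n) p.2 (excess (scale n) (hscale n) p.1 p.2) with hF
  set G := fun p : ℝ × ℝ => 2 * (g (point n p.1 p.2) * (exp (-p.1 - p.2 ^ 2) / √π)) with hG
  have hGi : Integrable G (quadrant t) := hi.const_mul 2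
  have hbound : ∀ᵐ p ∂(quadrant t), ‖F p - G p‖ ≤ edgeMajorant
      ((√(2 * n) / hscale n) ^ (-(1 / 2) : ℝ)) (6 * e + 2 * ε) (13 / scale n) p := by
    filter_upwards [ae_quadrant t] with p hp
    have h2 := abs_edgeDensity_sub_le_majorant H hc hc' he (x := p.1) (y := p.2)
      (by linarith [hp.1]) hp.2
    have h3 : F p - G p = g (point n p.1 p.2)
        * (edgeDensity n (hscale n) p.2 (excess (scale n) (hscale n) p.1 p.2)
          - 2 * (exp (-p.1 - p.2 ^ 2) / √π)) := by rw [hF, hG]; ring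
    rw [h3, norm_mul, norm_of_nonneg (hg _).1, Real.norm_eq_abs]
    exact (mul_le_of_le_one_left (abs_nonneg _) (hg _).2).trans h2
  -- Integrability of the exact density is obtained from that of its error and of its limit.
  have hFGi : Integrable (fun p => F p - G p) (quadrant t) :=
    hM.mono' (hmeas.aestronglyMeasurable.sub hGi.aestronglyMeasurable) hbound
  have hFi : Integrable F (quadrant t) := by
    have := hFGi.add hGi
    refine this.congr (Eventually.of_forall fun p => ?_)
    simp
  rw [h1, hI, ← integral_const_mul, ← integral_sub hFi hGi, ← Real.norm_eq_abs]
  refine (norm_integral_le_of_norm_le hM hbound).trans ?_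
  rw [hMI]

/-! ### The Hilbert-Schmidt norm -/

lemma im_mul_erfcx_le {n : ℕ} (hn : 0 < n) {b : ℝ} (hb : 0 ≤ b) :
    b * erfcx (√(2 * n) * b) ≤ 1 / √(2 * π * n) := by
  have hn' : (0 : ℝ) < n := by exact_mod_cast hn
  rcases hb.eq_or_lt with rfl | hb
  · simp; positivity
  have h := mul_erfcx_le_one (s := √(2 * n) * b) (by positivity)
  have h1 : √(2 * π * n) = √π * √(2 * n) := by
    rw [← sqrt_mul pi_pos.le]; congr 1; ring
  rw [le_div_iff₀ (by positivity), h1]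
  linarith

/-- Split `|conj w - z|^2` as `|z-w|^2 + 4 Im z Im w`. The first part is at most the denominator; in
the second, each imaginary part is absorbed by its `erfcx` factor. -/
lemma sq_norm_scalarKernel_le_add {n : ℕ} (hn : 0 < n) {z w : ℂ} (hz : 1 < ‖z‖) (hw : 1 < ‖w‖)
    (hzi : 0 ≤ z.im) (hwi : 0 ≤ w.im) :
    ‖scalarKernel n z w‖ ^ 2 ≤ (n / π) ^ 2 * (ldWeight n (‖z‖ ^ 2) * ldWeight n (‖w‖ ^ 2))
      * (erfcx (√(2 * n) * z.im) * erfcx (√(2 * n) * w.im)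
        + 2 / (π * n) / ((z.im - w.im) ^ 2 + (‖z‖ ^ 2 - 1) * (‖w‖ ^ 2 - 1))) := by
  have hn' : (0 : ℝ) < n := by exact_mod_cast hn
  have h := sq_norm_scalarKernel_le hn hz hw
  rw [abs_of_nonneg hzi, abs_of_nonneg hwi] at h
  have h1 := norm_one_sub_mul_conj_sq z w
  have h2 := norm_conj_sub_sq z w
  have hz2 : 0 < ‖z‖ ^ 2 - 1 := by nlinarith
  have hw2 : 0 < ‖w‖ ^ 2 - 1 := by nlinarith
  have hm := mul_pos hz2 hw2
  have hb := im_mul_erfcx_le hn hzi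
  have hd := im_mul_erfcx_le hn hwi
  have h3 : (z.im - w.im) ^ 2 ≤ ‖z - w‖ ^ 2 := by
    rw [Complex.sq_norm, Complex.normSq_apply]; simp; nlinarith [mul_self_nonneg (z.re - w.re)]
  set A := erfcx (√(2 * n) * z.im)
  set B := erfcx (√(2 * n) * w.im)
  have hA : 0 ≤ A := erfcx_nonneg _
  have hB : 0 ≤ B := erfcx_nonneg _
  set D := ‖z * conj w - 1‖ ^ 2
  have hD : 0 < D := by rw [h1]; positivity
  have h4 : A * B * (‖conj w - z‖ ^ 2 / D)
      ≤ A * B + 2 / (π * n) / ((z.im - w.im) ^ 2 + (‖z‖ ^ 2 - 1) * (‖w‖ ^ 2 - 1)) := by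
    have h5 : A * B * (‖conj w - z‖ ^ 2 / D)
        = A * B * (‖z - w‖ ^ 2 / D) + 4 * ((z.im * A) * (w.im * B)) / D := by rw [h2]; ring
    have h6 : ‖z - w‖ ^ 2 / D ≤ 1 := by rw [div_le_one hD]; linarith
    have h7 : 4 * ((z.im * A) * (w.im * B)) ≤ 2 / (π * n) := by
      calc 4 * ((z.im * A) * (w.im * B))
          ≤ 4 * (1 / √(2 * π * n) * (1 / √(2 * π * n))) := by gcongr
        _ = 4 * (1 / (√(2 * π * n) * √(2 * π * n))) := by rw [div_mul_div_comm, one_mul]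
        _ = 2 / (π * n) := by rw [mul_self_sqrt (by positivity)]; field_simp; norm_num
    rw [h5]
    refine add_le_add (mul_le_of_le_one_right (by positivity) h6) ?_
    have h8 : (z.im - w.im) ^ 2 + (‖z‖ ^ 2 - 1) * (‖w‖ ^ 2 - 1) ≤ D := by linarith
    have h9 : 0 < (z.im - w.im) ^ 2 + (‖z‖ ^ 2 - 1) * (‖w‖ ^ 2 - 1) := by positivity
    gcongr
  have hW : 0 ≤ ldWeight n (‖z‖ ^ 2) * ldWeight n (‖w‖ ^ 2) :=
    mul_nonneg (ldWeight_nonneg _ (by positivity)) (ldWeight_nonneg _ (by positivity))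
  calc _ ≤ _ := h
    _ = (n / π) ^ 2 * (ldWeight n (‖z‖ ^ 2) * ldWeight n (‖w‖ ^ 2))
        * (A * B * (‖conj w - z‖ ^ 2 / D)) := by ring
    _ ≤ _ := by gcongr

/-- This serves the off-diagonal entries, where one argument is conjugated and no Cauchy term
arises. -/
lemma sq_norm_scalarKernel_le_of_opposite {n : ℕ} (hn : 0 < n) {z w : ℂ} (hz : 1 < ‖z‖)
    (hw : 1 < ‖w‖) (hzw : z.im * w.im ≤ 0) :
    ‖scalarKernel n z w‖ ^ 2 ≤ (n / π) ^ 2 * (ldWeight n (‖z‖ ^ 2) * ldWeight n (‖w‖ ^ 2))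
      * (erfcx (√(2 * n) * |z.im|) * erfcx (√(2 * n) * |w.im|)) := by
  have h := sq_norm_scalarKernel_le hn hz hw
  have h1 := norm_one_sub_mul_conj_sq z w
  have h2 := norm_conj_sub_sq z w
  have hz2 : 0 < ‖z‖ ^ 2 - 1 := by nlinarith
  have hw2 : 0 < ‖w‖ ^ 2 - 1 := by nlinarith
  have hm := mul_pos hz2 hw2
  have hD : 0 < ‖z * conj w - 1‖ ^ 2 := by rw [h1]; positivity
  have h3 : ‖conj w - z‖ ^ 2 / ‖z * conj w - 1‖ ^ 2 ≤ 1 := by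
    rw [div_le_one hD]; linarith
  have hA := erfcx_nonneg (√(2 * n) * |z.im|)
  have hB := erfcx_nonneg (√(2 * n) * |w.im|)
  have hW : 0 ≤ ldWeight n (‖z‖ ^ 2) * ldWeight n (‖w‖ ^ 2) :=
    mul_nonneg (ldWeight_nonneg _ (by positivity)) (ldWeight_nonneg _ (by positivity))
  calc _ ≤ _ := h
    _ ≤ _ := mul_le_of_le_one_right (by positivity) h3
    _ = _ := by ring

lemma sum_enorm_sandwich {g : ℂ → ℝ} (hg : ∀ z, 0 ≤ g z ∧ g z ≤ 1) (n : ℕ) (z w : ℂ) :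
    ∑ i, ∑ j, ‖sandwich g (matrixKernel n) z w i j‖ₑ ^ 2
      ≤ ENNReal.ofReal (‖scalarKernel n z w‖ ^ 2 + ‖scalarKernel n z (conj w)‖ ^ 2
        + (‖scalarKernel n (conj z) w‖ ^ 2 + ‖scalarKernel n w z‖ ^ 2)) := by
  have hb : ‖((√(g z) * √(g w) : ℝ) : ℂ)‖ ≤ 1 := by
    rw [Complex.norm_real, norm_of_nonneg (by positivity)]
    exact mul_le_one₀ (sqrt_le_one.2 (hg z).2) (sqrt_nonneg _) (sqrt_le_one.2 (hg w).2)
  have key : ∀ s : ℂ, ‖((√(g z) * √(g w) : ℝ) : ℂ) * s‖ₑ ^ 2 ≤ ENNReal.ofReal (‖s‖ ^ 2) := by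
    intro s
    rw [← ofReal_norm, ← ENNReal.ofReal_pow (norm_nonneg _)]
    refine ENNReal.ofReal_le_ofReal (pow_le_pow_left₀ (norm_nonneg _) ?_ 2)
    rw [norm_mul]
    exact mul_le_of_le_one_left (norm_nonneg _) hb
  have h1 := key (scalarKernel n z w)
  have h2 := key (-Complex.I * scalarKernel n z (conj w))
  have h3 := key (-Complex.I * scalarKernel n (conj z) w)
  have h4 := key (scalarKernel n w z)
  rw [norm_mul, norm_neg, Complex.norm_I, one_mul] at h2 h3
  rw [ENNReal.ofReal_add (by positivity) (by positivity),
    ENNReal.ofReal_add (by positivity) (by positivity),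
    ENNReal.ofReal_add (by positivity) (by positivity)]
  simp only [Fin.sum_univ_two, sandwich, matrixKernel, Matrix.smul_apply, smul_eq_mul,
    Matrix.of_apply, Matrix.cons_val', Matrix.cons_val_zero, Matrix.cons_val_one,
    Matrix.cons_val_fin_one]
  exact add_le_add (add_le_add h1 h2) (add_le_add h3 h4)

lemma sum_sq_norm_scalarKernel_le {n : ℕ} (hn : 0 < n) {z w : ℂ} (hz : 1 < ‖z‖) (hw : 1 < ‖w‖)
    (hzi : 0 ≤ z.im) (hwi : 0 ≤ w.im) :
    ‖scalarKernel n z w‖ ^ 2 + ‖scalarKernel n z (conj w)‖ ^ 2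
        + (‖scalarKernel n (conj z) w‖ ^ 2 + ‖scalarKernel n w z‖ ^ 2)
      ≤ 4 * (n / π) ^ 2 * (ldWeight n (‖z‖ ^ 2) * ldWeight n (‖w‖ ^ 2))
      * (erfcx (√(2 * n) * z.im) * erfcx (√(2 * n) * w.im)
        + 2 / (π * n) / ((z.im - w.im) ^ 2 + (‖z‖ ^ 2 - 1) * (‖w‖ ^ 2 - 1))) := by
  have hn' : (0 : ℝ) < n := by exact_mod_cast hn
  have h1 := sq_norm_scalarKernel_le_add hn hz hw hzi hwi
  have h4 := sq_norm_scalarKernel_le_add hn hw hz hwi hzi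
  have h2 := sq_norm_scalarKernel_le_of_opposite hn (w := conj w) hz (by simpa using hw)
    (by simp; positivity)
  have h3 := sq_norm_scalarKernel_le_of_opposite hn (z := conj z) (by simpa using hz) hw
    (by simp; positivity)
  simp only [Complex.conj_im, abs_neg, RCLike.norm_conj, abs_of_nonneg hzi, abs_of_nonneg hwi]
    at h2 h3
  have e1 : (w.im - z.im) ^ 2 + (‖w‖ ^ 2 - 1) * (‖z‖ ^ 2 - 1)
      = (z.im - w.im) ^ 2 + (‖z‖ ^ 2 - 1) * (‖w‖ ^ 2 - 1) := by ring
  rw [e1] at h4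
  have hz2 : 0 < ‖z‖ ^ 2 - 1 := by nlinarith
  have hw2 : 0 < ‖w‖ ^ 2 - 1 := by nlinarith
  have hW : 0 ≤ (n / π) ^ 2 * (ldWeight n (‖z‖ ^ 2) * ldWeight n (‖w‖ ^ 2)) :=
    mul_nonneg (by positivity)
      (mul_nonneg (ldWeight_nonneg _ (by positivity)) (ldWeight_nonneg _ (by positivity)))
  have hR : 0 ≤ (n / π) ^ 2 * (ldWeight n (‖z‖ ^ 2) * ldWeight n (‖w‖ ^ 2))
      * (2 / (π * n) / ((z.im - w.im) ^ 2 + (‖z‖ ^ 2 - 1) * (‖w‖ ^ 2 - 1))) := by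
    refine mul_nonneg hW (by positivity)
  linarith

/-- The Cauchy-type profile `1 / ((y - y') ^ 2 / h ^ 2 + γ / (4 n))`. -/
def cauchyProfile (n : ℕ) (γ h y y' : ℝ) : ℝ := 1 / ((y - y') ^ 2 / h ^ 2 + γ / (4 * n))

/-- An arctangent integral of width `hm`, `m^2 = γ/(4n)`. Its value does not depend on `y`, which
decouples the two points. -/
lemma integral_cauchyProfile {n : ℕ} {γ h : ℝ} (hn : 0 < n) (hγ : 0 < γ) (hh : 0 < h) (y : ℝ) :
    Integrable (cauchyProfile n γ h y) ∧
      ∫ y', cauchyProfile n γ h y y' = π * h * (2 * √n / √γ) := by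
  have hn' : (0 : ℝ) < n := by exact_mod_cast hn
  set m := √γ / (2 * √n) with hm
  have hmp : 0 < m := by positivity
  have hm2 : m ^ 2 = γ / (4 * n) := by
    rw [hm, div_pow, mul_pow, sq_sqrt hγ.le, sq_sqrt hn'.le]; norm_num
  have h1 : cauchyProfile n γ h y
      = fun y' => 1 / m ^ 2 * (fun x : ℝ => (1 + x ^ 2)⁻¹) ((y' - y) / (h * m)) := by
    ext y'
    have h2 : (y - y') ^ 2 / h ^ 2 + γ / (4 * n) = m ^ 2 * (1 + ((y' - y) / (h * m)) ^ 2) := by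
      rw [← hm2]; field_simp; ring
    rw [cauchyProfile, h2, one_div, mul_inv, one_div]
  have hi : Integrable fun y' : ℝ => (1 + ((y' - y) / (h * m)) ^ 2)⁻¹ :=
    ((integrable_inv_one_add_sq.comp_div (by positivity : h * m ≠ 0)).comp_sub_right y)
  rw [h1]
  refine ⟨hi.const_mul _, ?_⟩
  rw [integral_const_mul,
    integral_sub_right_eq_self (fun x : ℝ => (fun x : ℝ => (1 + x ^ 2)⁻¹) (x / (h * m))) y,
    Measure.integral_comp_div (fun x : ℝ => (1 + x ^ 2)⁻¹) (h * m), integral_univ_inv_one_add_sq, abs_of_pos (by positivity), smul_eq_mul]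
  have : 2 * √n / √γ = 1 / m := by rw [hm]; field_simp
  rw [this]
  field_simp

/-- The integrable majorant for the squared matrix kernel in rescaled coordinates. -/
def hsMajorant (n : ℕ) (γ h M κ : ℝ) (p q : ℝ × ℝ) : ℝ :=
  M * κ ^ 2 * (exp (-p.1) * (p.2 ^ (-(1 / 2) : ℝ) * exp (-p.2 ^ 2)))
      * (exp (-q.1) * (q.2 ^ (-(1 / 2) : ℝ) * exp (-q.2 ^ 2)))
    + M * (2 / (π * n)) * (exp (-p.1) * exp (-p.2 ^ 2))
      * (exp (-q.1) * cauchyProfile n γ h p.2 q.2)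

lemma cauchyProfile_nonneg {n : ℕ} {γ h : ℝ} (hγ : 0 < γ) (y y' : ℝ) :
    0 ≤ cauchyProfile n γ h y y' := by unfold cauchyProfile; positivity

lemma lintegral_hsMajorant_le {n : ℕ} {γ h M κ t : ℝ} (hn : 0 < n) (hγ : 1 ≤ γ) (hh : 0 < h)
    (hM : 0 ≤ M) :
    ∫⁻ p, ∫⁻ q, ENNReal.ofReal (hsMajorant n γ h M κ p q) ∂(quadrant t) ∂(quadrant t)
      ≤ ENNReal.ofReal (M * exp (-t) ^ 2 * (κ ^ 2 * halfMoment ^ 2 + 4 * h / √n)) := by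
  have hn' : (0 : ℝ) < n := by exact_mod_cast hn
  have hγ0 : 0 < γ := by linarith
  have hx := integrableOn_exp_neg_Ioi t
  have i1 := integrable_quadrant_mul hx (integrableOn_rpow_gaussian (s := -(1 / 2)) (by norm_num))
  have i2 := integrable_quadrant_mul hx (integrable_exp_neg_sq.integrableOn (s := Ioi 0))
  have v1 : ∫ p, exp (-p.1) * (p.2 ^ (-(1 / 2) : ℝ) * exp (-p.2 ^ 2)) ∂(quadrant t)
      = exp (-t) * halfMoment := by
    rw [integral_quadrant_mul t (fun x => exp (-x)) (fun y => y ^ (-(1 / 2) : ℝ) * exp (-y ^ 2)),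
      integral_exp_neg_Ioi, halfMoment]
  have v2 : ∫ p, exp (-p.1) * exp (-p.2 ^ 2) ∂(quadrant t) = exp (-t) * (√π / 2) := by
    rw [integral_quadrant_mul t (fun x => exp (-x)) (fun y => exp (-y ^ 2)),
      integral_exp_neg_Ioi, integral_gaussian_half]
  have hpos : ∀ p q : ℝ × ℝ, 0 < p.2 → 0 < q.2 → 0 ≤ hsMajorant n γ h M κ p q := by
    intro p q hp hq
    have := cauchyProfile_nonneg (n := n) (h := h) hγ0 p.2 q.2
    unfold hsMajorant; positivity
  set N : ℝ × ℝ → ℝ := fun p =>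
    M * κ ^ 2 * (exp (-t) * halfMoment) * (exp (-p.1) * (p.2 ^ (-(1 / 2) : ℝ) * exp (-p.2 ^ 2)))
      + M * (4 * h / √n) * exp (-t) * (exp (-p.1) * exp (-p.2 ^ 2)) with hN
  have inner : ∀ p : ℝ × ℝ, 0 < p.2 →
      ∫⁻ q, ENNReal.ofReal (hsMajorant n γ h M κ p q) ∂(quadrant t) ≤ ENNReal.ofReal (N p) := by
    intro p hp
    obtain ⟨c1, c2⟩ := integral_cauchyProfile hn hγ0 hh p.2
    have i3 := integrable_quadrant_mul hx c1.integrableOn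
    have i4 := i1.const_mul (M * κ ^ 2 * (exp (-p.1) * (p.2 ^ (-(1 / 2) : ℝ) * exp (-p.2 ^ 2))))
    have i5 := i3.const_mul (M * (2 / (π * n)) * (exp (-p.1) * exp (-p.2 ^ 2)))
    have i6 : Integrable (hsMajorant n γ h M κ p) (quadrant t) := i4.add i5
    rw [← ofReal_integral_eq_lintegral_ofReal i6
      ((ae_quadrant t).mono fun q hq => hpos p q hp hq.2)]
    refine ENNReal.ofReal_le_ofReal ?_
    unfold hsMajorant
    rw [integral_add i4 i5, integral_const_mul, integral_const_mul, v1,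
      integral_quadrant_mul t (fun x => exp (-x)) (cauchyProfile n γ h p.2), integral_exp_neg_Ioi]
    have h1 : ∫ y in Ioi (0 : ℝ), cauchyProfile n γ h p.2 y ≤ π * h * (2 * √n / √γ) := by
      rw [← c2]
      exact setIntegral_le_integral c1
        (Eventually.of_forall fun y => cauchyProfile_nonneg hγ0 _ _)
    -- The Cauchy integral costs `h√n` against the prefactor `1/n`; the net gain `h/√n` matches that
    -- of the `erfcx` term.
    have h2 : 2 / (π * n) * (π * h * (2 * √n / √γ)) ≤ 4 * h / √n := by
      have e1 : 2 / (π * n) * (π * h * (2 * √n / √γ)) = 4 * h / √n * (1 / √γ) := by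
        have : (n : ℝ) = √n * √n := (mul_self_sqrt hn'.le).symm
        nth_rw 1 [this]
        field_simp
        norm_num
      rw [e1]
      refine mul_le_of_le_one_right (by positivity) ?_
      rw [div_le_one (by positivity)]
      exact one_le_sqrt.2 hγ
    have h3 : 2 / (π * n) * ∫ y in Ioi (0 : ℝ), cauchyProfile n γ h p.2 y ≤ 4 * h / √n :=
      (mul_le_mul_of_nonneg_left h1 (by positivity)).trans h2
    have h4 := mul_le_mul_of_nonneg_left h3
      (by positivity : 0 ≤ M * exp (-t) * (exp (-p.1) * exp (-p.2 ^ 2)))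
    rw [hN]
    simp only
    linarith
  have iN : Integrable N (quadrant t) := (i1.const_mul _).add (i2.const_mul _)
  calc _ ≤ ∫⁻ p, ENNReal.ofReal (N p) ∂(quadrant t) :=
        lintegral_mono_ae ((ae_quadrant t).mono fun p hp => inner p hp.2)
    _ = ENNReal.ofReal (∫ p, N p ∂(quadrant t)) := by
        rw [ofReal_integral_eq_lintegral_ofReal iN]
        refine (ae_quadrant t).mono fun p hp => ?_
        have := halfMoment_nonneg
        have := hp.2
        simp only [hN, Pi.zero_apply]
        positivity
    _ ≤ _ := by
        refine ENNReal.ofReal_le_ofReal ?_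
        rw [hN, integral_add (i1.const_mul _) (i2.const_mul _), integral_const_mul,
          integral_const_mul, v1, v2]
        have h1 : √π / 2 ≤ 1 := by
          rw [div_le_one two_pos]
          exact sqrt_le_iff.2 ⟨by norm_num, by linarith [pi_le_four]⟩
        have h2 := mul_le_mul_of_nonneg_left h1
          (by positivity : 0 ≤ M * (4 * h / √n) * exp (-t) * exp (-t))
        linarith

lemma sum_sq_norm_point_le {n : ℕ} {ε t : ℝ} (H : EdgeRegime n (scale n) (hscale n) ε)
    (ht : -(scale n / 2) ≤ t) {p q : ℝ × ℝ} (hp : t < p.1 ∧ 0 < p.2) (hq : t < q.1 ∧ 0 < q.2) :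
    ‖scalarKernel n (point n p.1 p.2) (point n q.1 q.2)‖ ^ 2
        + ‖scalarKernel n (point n p.1 p.2) (conj (point n q.1 q.2))‖ ^ 2
        + (‖scalarKernel n (conj (point n p.1 p.2)) (point n q.1 q.2)‖ ^ 2
        + ‖scalarKernel n (point n q.1 q.2) (point n p.1 p.2)‖ ^ 2)
      ≤ hsMajorant n (scale n) (hscale n) (36 * (n / π) ^ 2 * exp (-(scale n / 2)) ^ 2)
        ((√(2 * n) / hscale n) ^ (-(1 / 2) : ℝ)) p q := by
  have hn := H.n_pos
  have hn' := H.n_pos'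
  have hγ := H.γ_pos
  have hh := H.h_pos
  have hex : ∀ r : ℝ × ℝ, t < r.1 ∧ 0 < r.2 →
      1 < ‖point n r.1 r.2‖ ∧ scale n / (2 * hscale n ^ 2) ≤ ‖point n r.1 r.2‖ ^ 2 - 1 ∧
      ldWeight n (‖point n r.1 r.2‖ ^ 2)
        ≤ 3 * (exp (-(scale n / 2)) * (exp (-r.1) * exp (-r.2 ^ 2))) ∧
      erfcx (√(2 * n) * (point n r.1 r.2).im)
        ≤ (√(2 * n) / hscale n) ^ (-(1 / 2) : ℝ) * r.2 ^ (-(1 / 2) : ℝ) := by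
    intro r hr
    obtain ⟨h1, h2⟩ := excess_bounds (x := r.1) (y := r.2) H (by linarith [hr.1])
    have hb : scale n / 2 ≤ scale n + (r.1 + r.2 ^ 2) := by nlinarith [hr.1, hr.2]
    have h3 : scale n / (2 * hscale n ^ 2) ≤ excess (scale n) (hscale n) r.1 r.2 := by
      refine le_trans ?_ h1
      rw [← div_div]
      gcongr
    have h4 := norm_point_sq hn hγ r.1 r.2
    have h5 : 0 < scale n / (2 * hscale n ^ 2) := by positivity
    refine ⟨?_, by linarith, ?_, ?_⟩
    · by_contra! h
      nlinarith [norm_nonneg (point n r.1 r.2)]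
    · rw [h4]
      refine (H.ldWeight_le (by linarith) h1 h2).trans (le_of_eq ?_)
      rw [← exp_add, ← exp_add]
      congr 2; ring
    · rw [point_im, ← mul_rpow (by positivity) hr.2.le]
      have h6 : √(2 * n) * (r.2 / hscale n) = √(2 * n) / hscale n * r.2 := by ring
      rw [h6]
      have := hr.2
      exact erfcx_le_rpow (by positivity)
  obtain ⟨p1, p2, p3, p4⟩ := hex p hp
  obtain ⟨q1, q2, q3, q4⟩ := hex q hq
  have hpi : 0 ≤ (point n p.1 p.2).im := by rw [point_im]; have := hp.2; positivity
  have hqi : 0 ≤ (point n q.1 q.2).im := by rw [point_im]; have := hq.2; positivity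
  refine (sum_sq_norm_scalarKernel_le hn p1 q1 hpi hqi).trans ?_
  -- Each excess is at least `γ/(2h^2)` because `x ≥ -γ/2`, and `h^4 = γn`.
  have hm : scale n / (4 * n)
      ≤ (‖point n p.1 p.2‖ ^ 2 - 1) * (‖point n q.1 q.2‖ ^ 2 - 1) := by
    have e1 : scale n / (4 * n)
        = scale n / (2 * hscale n ^ 2) * (scale n / (2 * hscale n ^ 2)) := by
      rw [div_mul_div_comm]
      have : 2 * hscale n ^ 2 * (2 * hscale n ^ 2) = 4 * hscale n ^ 4 := by ring
      rw [this, H.h_pow]; field_simp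
    rw [e1]
    gcongr
    exact le_trans (by positivity) p2
  have hden : 2 / (π * n) / (((point n p.1 p.2).im - (point n q.1 q.2).im) ^ 2
      + (‖point n p.1 p.2‖ ^ 2 - 1) * (‖point n q.1 q.2‖ ^ 2 - 1))
      ≤ 2 / (π * n) * cauchyProfile n (scale n) (hscale n) p.2 q.2 := by
    unfold cauchyProfile
    rw [point_im, point_im, ← sub_div, div_pow, mul_one_div]
    gcongr
  have hP := ldWeight_nonneg n (sq_nonneg ‖point n p.1 p.2‖)
  have hQ := ldWeight_nonneg n (sq_nonneg ‖point n q.1 q.2‖)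
  have hEp := erfcx_nonneg (√(2 * n) * (point n p.1 p.2).im)
  have hEq := erfcx_nonneg (√(2 * n) * (point n q.1 q.2).im)
  have hC := cauchyProfile_nonneg (n := n) (h := hscale n) hγ p.2 q.2
  have hp2 := hp.2
  have hq2 := hq.2
  set κ := (√(2 * n) / hscale n) ^ (-(1 / 2) : ℝ)
  calc _ ≤ 4 * (n / π) ^ 2 * (3 * (exp (-(scale n / 2)) * (exp (-p.1) * exp (-p.2 ^ 2)))
        * (3 * (exp (-(scale n / 2)) * (exp (-q.1) * exp (-q.2 ^ 2)))))
        * (κ * p.2 ^ (-(1 / 2) : ℝ) * (κ * q.2 ^ (-(1 / 2) : ℝ))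
          + 2 / (π * n) * cauchyProfile n (scale n) (hscale n) p.2 q.2) := by
        gcongr
        refine add_nonneg (by positivity) (div_nonneg (by positivity) ?_)
        exact add_nonneg (sq_nonneg _) (le_trans (by positivity) hm)
    _ = 36 * (n / π) ^ 2 * exp (-(scale n / 2)) ^ 2 * κ ^ 2
          * (exp (-p.1) * (p.2 ^ (-(1 / 2) : ℝ) * exp (-p.2 ^ 2)))
          * (exp (-q.1) * (q.2 ^ (-(1 / 2) : ℝ) * exp (-q.2 ^ 2)))
        + 36 * (n / π) ^ 2 * exp (-(scale n / 2)) ^ 2 * (2 / (π * n))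
          * (exp (-p.1) * exp (-p.2 ^ 2)) * (exp (-q.1)
            * (exp (-q.2 ^ 2) * cauchyProfile n (scale n) (hscale n) p.2 q.2)) := by ring
    _ ≤ _ := by
        unfold hsMajorant
        gcongr
        -- The Gaussian in `q.2` is dropped, the Cauchy profile being integrable by itself.
        exact mul_le_of_le_one_left hC (exp_le_one_iff.2 (by nlinarith))

/-- Two Jacobians times the kernel prefactor reproduce the normalization of the trace, so no new
asymptotics are needed. -/
lemma normRatio_sq_mul {n : ℕ} {γ h ε : ℝ} (H : EdgeRegime n γ h ε) :
    1 / (2 * h ^ 3) * (1 / (2 * h ^ 3)) * (36 * (n / π) ^ 2 * exp (-(γ / 2)) ^ 2)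
      = 72 * γ * normRatio n γ h ^ 2 := by
  have hγ := H.γ_pos
  have hh := H.h_pos
  have hn := H.n_pos'
  have h1 : normRatio n γ h ^ 2 = n * exp (-(γ / 2)) ^ 2 / (8 * π ^ 2 * h ^ 2 * γ ^ 2) := by
    unfold normRatio
    simp only [div_pow, mul_pow]
    rw [sq_sqrt hn.le, sq_sqrt two_pos.le]
    norm_num
  rw [h1]
  have h2 : h ^ 6 = h ^ 2 * (γ * n) := by rw [← H.h_pow]; ring
  have h3 : 1 / (2 * h ^ 3) * (1 / (2 * h ^ 3)) = 1 / (4 * h ^ 6) := by field_simp; norm_num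
  rw [h3, h2]
  field_simp
  norm_num

theorem hsNorm_sandwich_le {n : ℕ} {ε t : ℝ} {g : ℂ → ℝ}
    (H : EdgeRegime n (scale n) (hscale n) ε)
    (hc : normRatio n (scale n) (hscale n) ≤ 2) (ht : -(scale n / 2) ≤ t)
    (hg : ∀ z, 0 ≤ g z ∧ g z ≤ 1) (hsupp : Function.support g ⊆ region n t) :
    hsNorm (sandwich g (matrixKernel n)) ≤ ENNReal.ofReal
      (288 * scale n * exp (-t) ^ 2 * ((halfMoment ^ 2 + 4) * (hscale n / √n))) ^ (1 / 2 : ℝ) := by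
  have hn := H.n_pos
  have hn' := H.n_pos'
  have hγ := H.γ_pos
  have hh := H.h_pos
  have hg0 : ∀ z ∉ region n t, g z = 0 := fun z hz => by
    by_contra h; exact hz (hsupp h)
  unfold hsNorm
  refine ENNReal.rpow_le_rpow ?_ (by norm_num)
  set J := ENNReal.ofReal (1 / (2 * hscale n ^ 3)) with hJ
  set M := 36 * (n / π) ^ 2 * exp (-(scale n / 2)) ^ 2 with hM
  set κ := (√(2 * n) / hscale n) ^ (-(1 / 2) : ℝ) with hκ
  set K := fun z w => ∑ i, ∑ j, ‖sandwich g (matrixKernel n) z w i j‖ₑ ^ 2 with hK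
  have hKw : ∀ z, ∀ w ∉ region n t, K z w = 0 := fun z w hw => by
    simp [hK, sandwich, hg0 w hw]
  have hKz : ∀ z ∉ region n t, ∀ w, K z w = 0 := fun z hz w => by
    simp [hK, sandwich, hg0 z hz]
  have step : ∫⁻ z in upper, ∫⁻ w in upper, K z w
      ≤ J * ∫⁻ p, J * ∫⁻ q, ENNReal.ofReal
        (hsMajorant n (scale n) (hscale n) M κ p q) ∂(quadrant t) ∂(quadrant t) := by
    refine (setLIntegral_upper_le hn hγ (t := t) fun z hz => by simp [hKz z hz]).trans ?_
    refine mul_le_mul' le_rfl ?_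
    refine lintegral_mono_ae ((ae_quadrant t).mono fun p hp => ?_)
    refine (setLIntegral_upper_le hn hγ (t := t) (hKw _)).trans ?_
    refine mul_le_mul' le_rfl ?_
    refine lintegral_mono_ae ((ae_quadrant t).mono fun q hq => ?_)
    exact (sum_enorm_sandwich hg n _ _).trans
      (ENNReal.ofReal_le_ofReal (sum_sq_norm_point_le H ht hp hq))
  refine step.trans ?_
  rw [lintegral_const_mul' _ _ ENNReal.ofReal_ne_top]
  refine (mul_le_mul_right (mul_le_mul_right (lintegral_hsMajorant_le hn H.one_le hh
    (by positivity)) J) J).trans ?_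
  rw [hJ, ← ENNReal.ofReal_mul (by positivity), ← ENNReal.ofReal_mul (by positivity)]
  refine ENNReal.ofReal_le_ofReal ?_
  have e1 := normRatio_sq_mul H
  rw [← hM] at e1
  have hκ2 : κ ^ 2 ≤ hscale n / √n := by
    rw [hκ, ← rpow_natCast, ← rpow_mul (by positivity)]
    norm_num
    rw [rpow_neg_one, inv_div]
    gcongr
    exact le_mul_of_one_le_left (sqrt_nonneg _) (one_le_sqrt.2 one_le_two)
  have hc0 : 0 ≤ normRatio n (scale n) (hscale n) := by unfold normRatio; positivity
  have hc2 : normRatio n (scale n) (hscale n) ^ 2 ≤ 4 := by nlinarith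
  calc _ = 1 / (2 * hscale n ^ 3) * (1 / (2 * hscale n ^ 3)) * M
        * (exp (-t) ^ 2 * (κ ^ 2 * halfMoment ^ 2 + 4 * hscale n / √n)) := by ring
    _ = 72 * scale n * normRatio n (scale n) (hscale n) ^ 2
        * (exp (-t) ^ 2 * (κ ^ 2 * halfMoment ^ 2 + 4 * hscale n / √n)) := by rw [e1]
    _ ≤ 72 * scale n * 4
        * (exp (-t) ^ 2 * (hscale n / √n * halfMoment ^ 2 + 4 * hscale n / √n)) := by gcongr
    _ = _ := by ring

/-! ### Bounds for a fixed dimension -/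

/-- Any crude bound works for fixed `n`. The rate `1/8` is chosen so that this factor and a second
one absorbing `|conj w - z|` still leave half of the weight `exp (-n(|z|^2+|w|^2)/2)`. -/
lemma norm_kernel_le (n : ℕ) (z w : ℂ) :
    ‖kernel n z w‖ ≤ n * 4 ^ n * exp (n * (‖z‖ ^ 2 + ‖w‖ ^ 2) / 8) := by
  unfold kernel
  refine (norm_sum_le _ _).trans ?_
  have h : ∀ l ∈ Finset.range n, ‖((n : ℂ) * z * conj w) ^ l / (Nat.factorial l : ℂ)‖
      ≤ 4 ^ n * exp (n * (‖z‖ ^ 2 + ‖w‖ ^ 2) / 8) := by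
    intro l hl
    have hl' : l ≤ n := (Finset.mem_range.1 hl).le
    simp only [norm_div, norm_pow, norm_mul, Complex.norm_natCast, RCLike.norm_conj]
    have h1 : n * ‖z‖ * ‖w‖ ≤ 4 * (n * (‖z‖ ^ 2 + ‖w‖ ^ 2) / 8) := by
      nlinarith [mul_nonneg (n.cast_nonneg (α := ℝ)) (sq_nonneg (‖z‖ - ‖w‖))]
    calc (n * ‖z‖ * ‖w‖) ^ l / (Nat.factorial l : ℝ)
        ≤ (4 * (n * (‖z‖ ^ 2 + ‖w‖ ^ 2) / 8)) ^ l / (Nat.factorial l : ℝ) := by gcongr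
      _ = 4 ^ l * ((n * (‖z‖ ^ 2 + ‖w‖ ^ 2) / 8) ^ l / (Nat.factorial l : ℝ)) := by
          rw [mul_pow]; ring
      _ ≤ 4 ^ n * exp (n * (‖z‖ ^ 2 + ‖w‖ ^ 2) / 8) := by
          gcongr
          · norm_num
          · exact pow_div_factorial_le_exp _ (by positivity) l
  refine (Finset.sum_le_sum h).trans (le_of_eq ?_)
  simp; ring

lemma exists_norm_scalarKernel_le {n : ℕ} (hn : 0 < n) :
    ∃ M : ℝ, 0 < M ∧ ∀ z w : ℂ, ‖scalarKernel n z w‖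
      ≤ M * (exp (-(n / 4 * ‖z‖ ^ 2)) * exp (-(n / 4 * ‖w‖ ^ 2))) := by
  have hn' : (0 : ℝ) < n := by exact_mod_cast hn
  have hn1 : (1 : ℝ) ≤ n := by exact_mod_cast hn
  refine ⟨n * √n / √(2 * π) * 8 * (n * 4 ^ n), by positivity, fun z w => ?_⟩
  rw [norm_scalarKernel]
  set r := ‖z‖ ^ 2 + ‖w‖ ^ 2 with hr
  have hr0 : 0 ≤ r := by positivity
  have h1 : ‖conj w - z‖ ≤ 8 * exp (n * r / 8) := by
    have e1 : ‖conj w - z‖ ≤ ‖w‖ + ‖z‖ := by simpa using norm_sub_le (conj w) z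
    have e2 := add_one_le_exp (n * r / 8)
    nlinarith [sq_nonneg (‖z‖ - 1), sq_nonneg (‖w‖ - 1)]
  have h2 : √(erfcx (√(2 * n) * |z.im|) * erfcx (√(2 * n) * |w.im|)) ≤ 1 :=
    sqrt_le_one.2 (mul_le_one₀ (erfcx_le_one (by positivity)) (erfcx_nonneg _)
      (erfcx_le_one (by positivity)))
  have h3 := norm_kernel_le n z w
  rw [← hr] at h3
  calc _ ≤ n * √n / √(2 * π) * (8 * exp (n * r / 8)) * 1 * exp (-(n * r / 2))
        * (n * 4 ^ n * exp (n * r / 8)) := by gcongr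
    _ = n * √n / √(2 * π) * 8 * (n * 4 ^ n)
        * (exp (n * r / 8) * exp (-(n * r / 2)) * exp (n * r / 8)) := by ring
    _ = _ := by
        congr 1
        rw [← exp_add, ← exp_add, ← exp_add, hr]
        congr 1; ring

lemma integrable_exp_neg_mul_norm_sq {c : ℝ} (hc : 0 < c) :
    Integrable fun z : ℂ => exp (-(c * ‖z‖ ^ 2)) := by
  have h := (GaussianFourier.integrable_cexp_neg_mul_sq_norm_add (V := ℂ) (b := (c : ℂ))
    (by simpa using hc) 0 0).norm
  refine h.congr (Eventually.of_forall fun z => ?_)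
  simp only [zero_mul, add_zero, Complex.norm_exp]
  congr 1
  norm_cast
  simp

lemma exists_fixed_bounds {n : ℕ} (hn : 0 < n) :
    ∃ C : ℝ, 0 < C ∧ ∀ g : ℂ → ℝ, Measurable g → (∀ z, 0 ≤ g z ∧ g z ≤ 1) →
      IntegrableOn (fun z => (sandwich g (matrixKernel n) z z).trace) upper ∧
      |∫ z in upper, g z * traceDensity n z| ≤ C ∧
      hsNorm (sandwich g (matrixKernel n)) ≤ ENNReal.ofReal C := by
  obtain ⟨M, hM, hS⟩ := exists_norm_scalarKernel_le hn
  have hn' : (0 : ℝ) < n := by exact_mod_cast hn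
  set G : ℂ → ℝ := fun z => exp (-(n / 4 * ‖z‖ ^ 2)) with hG
  have hGi : Integrable G := integrable_exp_neg_mul_norm_sq (by positivity)
  have hG0 : ∀ z, 0 < G z := fun z => exp_pos _
  have hG1 : ∀ z, G z ≤ 1 := fun z => exp_le_one_iff.2 (by
    have : 0 ≤ n / 4 * ‖z‖ ^ 2 := by positivity
    linarith)
  set I := ∫ z, G z with hI
  have hI0 : 0 ≤ I := integral_nonneg fun z => (hG0 z).le
  refine ⟨2 * M * I + 1, by positivity, fun g hgm hg => ?_⟩
  have hD : ∀ z ∈ upper, ‖g z * traceDensity n z‖ ≤ 2 * M * G z := by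
    intro z hz
    have h1 : traceDensity n z = 2 * ‖scalarKernel n z z‖ := by
      have h0 := traceDensity_nonneg n hz
      rw [traceDensity] at h0 ⊢
      rw [scalarKernel_self n hz, Complex.norm_real, norm_of_nonneg (by linarith)]
    have h2 := hS z z
    have h3 := hG1 z
    have h4 := (hG0 z).le
    rw [norm_mul, norm_of_nonneg (hg z).1, norm_of_nonneg (traceDensity_nonneg n hz), h1]
    calc g z * (2 * ‖scalarKernel n z z‖) ≤ 1 * (2 * (M * (G z * G z))) := by
          have := (hg z).2
          gcongr
      _ ≤ 1 * (2 * (M * (G z * 1))) := by gcongr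
      _ = _ := by ring
  have hDi : IntegrableOn (fun z => g z * traceDensity n z) upper := by
    refine (hGi.const_mul (2 * M)).integrableOn.mono'
      (hgm.mul (measurable_traceDensity n)).aestronglyMeasurable ?_
    exact (ae_restrict_mem measurableSet_upper).mono hD
  refine ⟨?_, ?_, ?_⟩
  · refine (integrableOn_congr_fun (fun z hz => ?_) measurableSet_upper).2 hDi.ofReal
    exact trace_sandwich (fun z => (hg z).1) n hz
  · rw [← Real.norm_eq_abs]
    refine (norm_integral_le_of_norm_le (hGi.const_mul (2 * M)).integrableOn
      ((ae_restrict_mem measurableSet_upper).mono hD)).trans ?_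
    rw [integral_const_mul]
    have : ∫ z in upper, G z ≤ I :=
      setIntegral_le_integral hGi (Eventually.of_forall fun z => (hG0 z).le)
    nlinarith
  · have hpt : ∀ z w : ℂ, ∑ i, ∑ j, ‖sandwich g (matrixKernel n) z w i j‖ₑ ^ 2
        ≤ ENNReal.ofReal (4 * M ^ 2 * G z * G w) := by
      intro z w
      refine (sum_enorm_sandwich hg n z w).trans (ENNReal.ofReal_le_ofReal ?_)
      have hsq : ∀ z' w' : ℂ, ‖z'‖ = ‖z‖ ∧ ‖w'‖ = ‖w‖ ∨ ‖z'‖ = ‖w‖ ∧ ‖w'‖ = ‖z‖ →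
          ‖scalarKernel n z' w'‖ ^ 2 ≤ M ^ 2 * G z * G w := by
        intro z' w' h
        have h1 : ‖scalarKernel n z' w'‖ ≤ M * (G z * G w) := by
          have h2 := hS z' w'
          rcases h with ⟨h, h'⟩ | ⟨h, h'⟩
          · rw [h, h'] at h2; exact h2
          · rw [h, h'] at h2; rw [mul_comm (G z)]; exact h2
        calc ‖scalarKernel n z' w'‖ ^ 2 ≤ (M * (G z * G w)) ^ 2 :=
              pow_le_pow_left₀ (norm_nonneg _) h1 2
          _ = M ^ 2 * G z * G w * (G z * G w) := by ring
          _ ≤ _ := mul_le_of_le_one_right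
              (mul_nonneg (mul_nonneg (sq_nonneg M) (hG0 z).le) (hG0 w).le)
              (mul_le_one₀ (hG1 z) (hG0 w).le (hG1 w))
      have a1 := hsq z w (by simp)
      have a2 := hsq z (conj w) (by simp)
      have a3 := hsq (conj z) w (by simp)
      have a4 := hsq w z (by simp)
      linarith
    have hlint : ∫⁻ z in upper, ∫⁻ w in upper,
        ∑ i, ∑ j, ‖sandwich g (matrixKernel n) z w i j‖ₑ ^ 2
          ≤ ENNReal.ofReal ((2 * M * I) ^ 2) := by
      have hGl : ∫⁻ z, ENNReal.ofReal (G z) = ENNReal.ofReal I :=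
        (ofReal_integral_eq_lintegral_ofReal hGi (Eventually.of_forall fun z => (hG0 z).le)).symm
      calc _ ≤ ∫⁻ z, ∫⁻ w, ENNReal.ofReal (4 * M ^ 2 * G z * G w) := by
            refine (lintegral_mono fun z => ?_).trans (setLIntegral_le_lintegral _ _)
            exact (lintegral_mono fun w => hpt z w).trans (setLIntegral_le_lintegral _ _)
        _ = ∫⁻ z, ENNReal.ofReal (4 * M ^ 2) * ENNReal.ofReal (G z) * ENNReal.ofReal I := by
            refine lintegral_congr fun z => ?_
            rw [← hGl, ← lintegral_const_mul' _ _
              (ENNReal.mul_ne_top ENNReal.ofReal_ne_top ENNReal.ofReal_ne_top)]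
            refine lintegral_congr fun w => ?_
            rw [ENNReal.ofReal_mul (mul_nonneg (by positivity) (hG0 z).le),
              ENNReal.ofReal_mul (by positivity)]
        _ = ENNReal.ofReal (4 * M ^ 2) * ENNReal.ofReal I * ENNReal.ofReal I := by
            rw [lintegral_mul_const' _ _ ENNReal.ofReal_ne_top,
              lintegral_const_mul' _ _ ENNReal.ofReal_ne_top, hGl]
        _ = _ := by
            rw [← ENNReal.ofReal_mul (by positivity), ← ENNReal.ofReal_mul (by positivity)]
            congr 1; ring
    unfold hsNorm
    refine (ENNReal.rpow_le_rpow hlint (by norm_num)).trans ?_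
    rw [ENNReal.ofReal_rpow_of_nonneg (by positivity) (by norm_num), ← sqrt_eq_rpow,
      sqrt_sq (by positivity)]
    exact ENNReal.ofReal_le_ofReal (by linarith)

lemma abs_limit_le {n : ℕ} {t : ℝ} {g : ℂ → ℝ} (hgm : Measurable g)
    (hg : ∀ z, 0 ≤ g z ∧ g z ≤ 1) :
    |2 * ∫ x in Ioi t, ∫ y in Ioi (0 : ℝ), g (point n x y) * (exp (-x - y ^ 2) / √π)|
      ≤ exp (-t) := by
  rw [(integral_limit_eq hgm hg).2, abs_mul, abs_two, ← Real.norm_eq_abs]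
  have hd := (integrable_quadrant_mul (integrableOn_exp_neg_Ioi t)
    (integrable_exp_neg_sq.integrableOn (s := Ioi 0))).div_const √π
  have h1 : ‖∫ p, g (point n p.1 p.2) * (exp (-p.1 - p.2 ^ 2) / √π) ∂(quadrant t)‖
      ≤ ∫ p, exp (-p.1) * exp (-p.2 ^ 2) / √π ∂(quadrant t) := by
    refine norm_integral_le_of_norm_le hd (Eventually.of_forall fun p => ?_)
    rw [norm_mul, norm_of_nonneg (hg _).1, norm_of_nonneg (by positivity), ← exp_add,
      sub_eq_add_neg]
    exact mul_le_of_le_one_left (by positivity) (hg _).2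
  rw [integral_div, integral_quadrant_mul t (fun x => exp (-x)) (fun y => exp (-y ^ 2)),
    integral_exp_neg_Ioi, integral_gaussian_half] at h1
  have h2 : exp (-t) * (√π / 2) / √π = exp (-t) / 2 := by field_simp
  linarith

/-- The three assertions of the main theorem for fixed `n`, with constant `C`. -/
def EdgeEstimate (n : ℕ) (C : ℝ) : Prop :=
  ∀ (t : ℝ) (g : ℂ → ℝ), 0 < scale n → |t| ≤ √(log n) / 10 → Measurable g →
    (∀ z, 0 ≤ g z ∧ g z ≤ 1) → Function.support g ⊆ region n t →
    IntegrableOn (fun z => (sandwich g (matrixKernel n) z z).trace) upper ∧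
    |(∫ z in upper, g z * traceDensity n z) - 2 * ∫ x in Ioi t, ∫ y in Ioi (0 : ℝ),
        g (point n x y) * (exp (-x - y ^ 2) / √π)|
      ≤ C * (exp (-t) * (log (log n) ^ 2 + |t| ^ 2) / log n) ∧
    hsNorm (sandwich g (matrixKernel n)) ≤ ENNReal.ofReal (C * exp (-√(log n) / 32))

/-- This makes `log n > 1`, hence `log log n > 0`, so the trace error bound cannot vanish even at `t
= 0`. -/
lemma three_le_of_scale_pos {n : ℕ} (h : 0 < scale n) : 3 ≤ n := by
  have hlog : 0 < log (2 * π ^ 4) :=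
    log_pos (by nlinarith [pi_gt_three, one_le_pow₀ (n := 4) (by linarith [pi_gt_three] : 1 ≤ π)])
  by_contra! hn
  interval_cases n
  · simp [scale] at h; linarith
  · simp [scale] at h; linarith
  -- For `n = 2` the term `-5 log log 2` is positive; it is at most `5/2`, less than `log (2π^4) -
  -- log 2 ≥ 6 log 2`.
  · have h1 := log_two_gt_d9
    have h2 := log_two_lt_d9
    have h3 := one_sub_inv_le_log_of_pos (x := log 2) (by linarith)
    have h4 : (log 2)⁻¹ ≤ 3 / 2 := by
      rw [inv_le_comm₀ (by linarith) (by norm_num)]; linarith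
    have h5 : 7 * log 2 ≤ log (2 * π ^ 4) := by
      have h6 : (3 : ℝ) ^ 4 ≤ π ^ 4 := pow_le_pow_left₀ (by norm_num) pi_gt_three.le 4
      have h7 : log ((2 : ℝ) ^ 7) ≤ log (2 * π ^ 4) := log_le_log (by norm_num) (by linarith)
      rw [log_pow] at h7
      exact_mod_cast h7
    unfold scale at h
    push_cast at h
    linarith

/-! ### Small and large dimensions -/

lemma EdgeEstimate.mono {n : ℕ} {C C' : ℝ} (h : EdgeEstimate n C) (hC : C ≤ C') :
    EdgeEstimate n C' := by
  intro t g hγ ht hgm hg hsupp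
  obtain ⟨h1, h2, h3⟩ := h t g hγ ht hgm hg hsupp
  have h0 : 0 ≤ log n := log_natCast_nonneg n
  refine ⟨h1, h2.trans ?_, h3.trans (ENNReal.ofReal_le_ofReal ?_)⟩
  · gcongr
  · gcongr

lemma exists_edgeEstimate (n : ℕ) : ∃ C : ℝ, 0 < C ∧ EdgeEstimate n C := by
  by_cases hγ : 0 < scale n
  swap
  · exact ⟨1, one_pos, fun t g h => absurd h hγ⟩
  have h3 := three_le_of_scale_pos hγ
  have h3' : (3 : ℝ) ≤ n := by exact_mod_cast h3
  obtain ⟨C, hC, hb⟩ := exists_fixed_bounds (n := n) (by omega)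
  have hL : 1 < log n := by
    rw [lt_log_iff_exp_lt (by linarith)]
    linarith [exp_one_lt_d9]
  set L := log n with hLdef
  have hLL : 0 < log L := log_pos hL
  have hLL2 : 0 < log L ^ 2 := by positivity
  have hL0 : 0 < L := by linarith
  set C₁ := (C * exp (√L / 10) + 1) * (L / log L ^ 2) with hC₁
  set C₂ := C * exp (√L / 32) with hC₂
  have hC₁0 : 0 < C₁ := by positivity
  have hC₂0 : 0 < C₂ := by positivity
  refine ⟨C₁ + C₂, by positivity, fun t g _ ht hgm hg _ => ?_⟩
  obtain ⟨h1, h2, h3⟩ := hb g hgm hg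
  refine ⟨h1, ?_, h3.trans (ENNReal.ofReal_le_ofReal ?_)⟩
  · have h4 := abs_limit_le (n := n) (t := t) hgm hg
    -- The restriction on `t` keeps `exp (-t)` away from 0, so a constant bound can be rewritten
    -- with this factor.
    have h5 : 1 ≤ exp (√L / 10) * exp (-t) := by
      rw [← exp_add]
      exact one_le_exp (by linarith [le_abs_self t])
    calc _ ≤ C * 1 + exp (-t) := (abs_sub _ _).trans (by linarith)
      _ ≤ C * (exp (√L / 10) * exp (-t)) + exp (-t) := by gcongr
      _ = C₁ * (exp (-t) * (log L ^ 2 + 0) / L) := by rw [hC₁]; field_simp; ring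
      _ ≤ (C₁ + C₂) * (exp (-t) * (log L ^ 2 + |t| ^ 2) / L) := by
          gcongr
          · linarith
          · positivity
  · have h6 : exp (√L / 32) * exp (-√L / 32) = 1 := by rw [← exp_add]; simp [neg_div]
    calc C = C₂ * exp (-√L / 32) := by rw [hC₂, mul_assoc, h6, mul_one]
      _ ≤ (C₁ + C₂) * exp (-√L / 32) := by gcongr; linarith

/-- Conditions, valid for large `n`, under which the edge asymptotics are effective. -/
structure LargeDim (n : ℕ) : Prop where
  log_large : 100 ≤ log n
  pow_le : log n ^ 10 ≤ n
  loglog_le : 36 * log (log n) ≤ log n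
  const_le : log (2 * π ^ 4) ≤ log (log n)

lemma eventually_largeDim : ∀ᶠ n : ℕ in atTop, LargeDim n := by
  have hlog : Tendsto (fun n : ℕ => log n) atTop atTop :=
    tendsto_log_atTop.comp tendsto_natCast_atTop_atTop
  have hll : Tendsto (fun n : ℕ => log (log n)) atTop atTop := tendsto_log_atTop.comp hlog
  have h1 := hlog.eventually_ge_atTop 100
  have h2 := hll.eventually_ge_atTop (log (2 * π ^ 4))
  have h3 : ∀ᶠ n : ℕ in atTop, log (n : ℝ) ^ 10 ≤ n := by
    have := (isLittleO_pow_log_id_atTop (n := 10)).bound one_pos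
    filter_upwards [tendsto_natCast_atTop_atTop.eventually this] with n hn
    simp only [Real.norm_eq_abs, one_mul, id] at hn
    rw [abs_of_nonneg (n.cast_nonneg (α := ℝ))] at hn
    exact (le_abs_self _).trans hn
  have h4 : ∀ᶠ n : ℕ in atTop, 36 * log (log n) ≤ log n := by
    have := isLittleO_log_id_atTop.bound (show (0 : ℝ) < 1 / 36 by norm_num)
    filter_upwards [hlog.eventually this, h1] with n hn hn1
    simp only [Real.norm_eq_abs, id] at hn
    rw [abs_of_nonneg (by linarith : (0 : ℝ) ≤ log n)] at hn
    linarith [le_abs_self (log (log (n : ℝ)))]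
  filter_upwards [h1, h2, h3, h4] with n a b c d
  exact ⟨a, c, d, b⟩

namespace LargeDim

variable {n : ℕ}

lemma loglog_ge (h : LargeDim n) : 1 ≤ log (log n) := by
  rw [le_log_iff_exp_le (by linarith [h.log_large])]
  linarith [exp_one_lt_d9, h.log_large]

lemma const_pos : 0 < log (2 * π ^ 4) :=
  log_pos (by nlinarith [pi_gt_three, one_le_pow₀ (n := 4) (by linarith [pi_gt_three] : 1 ≤ π)])

lemma scale_ge (h : LargeDim n) : log n / 4 ≤ scale n := by
  unfold scale
  linarith [h.loglog_le, h.const_le, h.loglog_ge]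

lemma scale_le (h : LargeDim n) : scale n ≤ log n / 2 := by
  unfold scale
  linarith [h.loglog_ge, const_pos]

lemma n_pos (h : LargeDim n) : 0 < n := by
  rcases Nat.eq_zero_or_pos n with rfl | hn
  · have := h.log_large; norm_num at this
  · exact hn

lemma edgeRegime (h : LargeDim n) : EdgeRegime n (scale n) (hscale n) (1 / log n) := by
  have h1 := h.log_large
  have h2 := h.scale_ge
  have h3 := h.scale_le
  have hγ : 0 < scale n := by linarith
  have hn := h.n_pos
  refine ⟨hn, by linarith, hscale_pos hn hγ, hscale_pow hγ, ?_, ?_⟩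
  · rw [div_le_one (by linarith)]; linarith
  · have hh := hscale_pos hn hγ
    rw [one_div, ← div_eq_inv_mul, le_div_iff₀ (by linarith)]
    -- After squaring, `h^4 = γn` reduces the claim to `128 L^5 ≤ n`, with `L = log n`, which
    -- follows from `L^10 ≤ n`.
    refine le_of_sq_le_sq ?_ (by positivity)
    have h4 := h.pow_le
    have e1 : (hscale n ^ 2) ^ 2 = scale n * n := by rw [← hscale_pow hγ]; ring
    rw [e1]
    set L := log (n : ℝ)
    have hL : 0 < L := by linarith
    calc (32 * scale n ^ 2 * L) ^ 2 = scale n * (1024 * scale n ^ 3 * L ^ 2) := by ring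
      _ ≤ scale n * (1024 * (L / 2) ^ 3 * L ^ 2) := by gcongr
      _ = scale n * (128 * L ^ 5) := by ring
      _ ≤ scale n * (L ^ 5 * L ^ 5) := by
          gcongr
          calc (128 : ℝ) ≤ 100 ^ 5 := by norm_num
            _ ≤ L ^ 5 := by gcongr
      _ = scale n * L ^ 10 := by ring
      _ ≤ scale n * n := by gcongr

/-- The terms in `γ` are tuned for this: `exp (-2γ) = 2π^4 (log n)^5/n` cancels every power of `n`,
`π` and 2 except those displayed. -/
lemma normRatio_pow (h : LargeDim n) :
    normRatio n (scale n) (hscale n) ^ 4 = (log n / (2 * scale n)) ^ 5 := by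
  have H := h.edgeRegime
  have hγ := H.γ_pos
  have hn := H.n_pos'
  have hL : 0 < log (n : ℝ) := by linarith [h.log_large]
  have hexp : exp (-(scale n / 2)) ^ 4 = log n ^ 5 * (2 * π ^ 4) / n := by
    rw [← exp_nat_mul]
    have e1 : ((4 : ℕ) : ℝ) * -(scale n / 2)
        = 5 * log (log n) + log (2 * π ^ 4) - log n := by
      unfold scale; push_cast; ring
    rw [e1, exp_sub, exp_add, exp_log hn, exp_log (by positivity)]
    have e2 : exp (5 * log (log n)) = log n ^ 5 := by
      have : (5 : ℝ) * log (log n) = ((5 : ℕ) : ℝ) * log (log n) := by norm_num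
      rw [this, exp_nat_mul, exp_log hL]
    rw [e2]
  have s1 : √(n : ℝ) ^ 4 = n ^ 2 := by
    rw [show (4 : ℕ) = 2 * 2 from rfl, pow_mul, sq_sqrt hn.le]
  have s2 : √(2 : ℝ) ^ 4 = 2 ^ 2 := by
    rw [show (4 : ℕ) = 2 * 2 from rfl, pow_mul, sq_sqrt two_pos.le]
  unfold normRatio
  simp only [div_pow, mul_pow]
  rw [hexp, s1, s2, H.h_pow]
  field_simp

lemma normRatio_bounds (h : LargeDim n) :
    1 ≤ normRatio n (scale n) (hscale n) ∧
      normRatio n (scale n) (hscale n) ≤ 1 + 36 * log (log n) / log n := by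
  have H := h.edgeRegime
  have hγ := H.γ_pos
  have hL : 0 < log (n : ℝ) := by linarith [h.log_large]
  have hh := H.h_pos
  have hc0 : 0 ≤ normRatio n (scale n) (hscale n) := by unfold normRatio; positivity
  have hp := h.normRatio_pow
  set q := log n / (2 * scale n) with hq
  set c := normRatio n (scale n) (hscale n)
  have hq1 : 1 ≤ q := by
    rw [hq, one_le_div (by positivity)]; linarith [h.scale_le]
  have hq2 : q ≤ 2 := by
    rw [hq, div_le_iff₀ (by positivity)]; linarith [h.scale_ge]
  have hq3 : q - 1 ≤ 12 * log (log n) / log n := by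
    have e1 : q - 1 = (log n - 2 * scale n) / (2 * scale n) := by rw [hq]; field_simp
    have e2 : log n - 2 * scale n ≤ 6 * log (log n) := by
      unfold scale; linarith [h.const_le]
    have h3 := h.loglog_ge
    rw [e1, div_le_div_iff₀ (by positivity) hL]
    nlinarith [h.scale_ge, h.loglog_ge, mul_le_mul_of_nonneg_right e2 hL.le]
  constructor
  · by_contra! hlt
    have : c ^ 4 < 1 := pow_lt_one₀ hc0 hlt (by norm_num)
    have : 1 ≤ q ^ 5 := one_le_pow₀ hq1
    linarith
  · have hcq : c ≤ q ^ 2 := by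
      refine le_of_pow_le_pow_left₀ (n := 4) (by norm_num) (by positivity) ?_
      rw [hp, ← pow_mul]
      exact pow_le_pow_right₀ hq1 (by norm_num)
    have e3 : 36 * log (log n) / log n = 3 * (12 * log (log n) / log n) := by ring
    rw [e3]
    nlinarith

lemma half_scale_le (h : LargeDim n) {t : ℝ} (ht : |t| ≤ √(log n) / 10) : -(scale n / 2) ≤ t := by
  have h1 := h.log_large
  have h2 : √(log n) ≤ log n := by
    rw [sqrt_le_left (by linarith)]; nlinarith
  linarith [neg_abs_le t, h.scale_ge]

lemma div_pow_le (h : LargeDim n) : (hscale n / √n) ^ 4 ≤ log n / n := by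
  have H := h.edgeRegime
  have hn := H.n_pos'
  rw [div_pow, H.h_pow, show (4 : ℕ) = 2 * 2 from rfl, pow_mul, sq_sqrt hn.le,
    div_le_div_iff₀ (by positivity) hn]
  have : scale n ≤ log n := by linarith [h.scale_le, h.log_large]
  nlinarith [mul_pos hn hn]

lemma rpow_le (h : LargeDim n) : (√(2 * n) / hscale n) ^ (-(1 / 2) : ℝ) ≤ 1 / log n := by
  have H := h.edgeRegime
  have hn := H.n_pos'
  have hh := H.h_pos
  have hL : 0 < log (n : ℝ) := by linarith [h.log_large]
  set κ := (√(2 * n) / hscale n) ^ (-(1 / 2) : ℝ) with hκ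
  have hκ2 : κ ^ 2 ≤ hscale n / √n := by
    have : κ ^ 2 = hscale n / √(2 * n) := by
      rw [hκ, ← rpow_natCast, ← rpow_mul (by positivity)]
      norm_num [rpow_neg_one]
    rw [this]
    gcongr
    linarith
  refine le_of_pow_le_pow_left₀ (n := 8) (by norm_num) (by positivity) ?_
  calc κ ^ 8 = (κ ^ 2) ^ 4 := by ring
    _ ≤ (hscale n / √n) ^ 4 := by gcongr
    _ ≤ log n / n := h.div_pow_le
    _ ≤ (1 / log n) ^ 8 := by
      rw [div_pow, one_pow, div_le_div_iff₀ hn (by positivity)]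
      calc log n * log n ^ 8 = log n ^ 9 * 1 := by ring
        _ ≤ log n ^ 9 * log n := by gcongr; linarith [h.log_large]
        _ = log n ^ 10 := by ring
        _ ≤ 1 * n := by linarith [h.pow_le]

lemma trace_estimate (h : LargeDim n) {t : ℝ} {g : ℂ → ℝ} (ht : |t| ≤ √(log n) / 10)
    (hgm : Measurable g) (hg : ∀ z, 0 ≤ g z ∧ g z ≤ 1)
    (hsupp : Function.support g ⊆ region n t) :
    |(∫ z in upper, g z * traceDensity n z) - 2 * ∫ x in Ioi t, ∫ y in Ioi (0 : ℝ),
        g (point n x y) * (exp (-x - y ^ 2) / √π)|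
      ≤ 2 * (halfMoment + 582 + 104 * fourthMoment)
        * (exp (-t) * (log (log n) ^ 2 + |t| ^ 2) / log n) := by
  have H := h.edgeRegime
  have hL : 0 < log (n : ℝ) := by linarith [h.log_large]
  have hγ := H.γ_pos
  obtain ⟨hc, hc'⟩ := h.normRatio_bounds
  have he : 36 * log (log n) / log n ≤ 1 := by rw [div_le_one hL]; exact h.loglog_le
  refine (abs_trace_sub_le H hc hc' he (h.half_scale_le ht) hgm hg hsupp).trans ?_
  have hπ : 2 / √π ≤ 2 := by
    rw [div_le_iff₀ (by positivity)]
    linarith [one_le_sqrt.2 (by linarith [pi_gt_three] : 1 ≤ π)]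
  have hπ2 : √π / 2 ≤ 1 := by
    rw [div_le_one two_pos]
    exact sqrt_le_iff.2 ⟨by norm_num, by linarith [pi_le_four]⟩
  have hinv : 13 / scale n ≤ 52 / log n := by
    rw [div_le_div_iff₀ hγ hL]; linarith [h.scale_ge]
  have hm := halfMoment_nonneg
  have hm4 := fourthMoment_nonneg
  have hl := h.loglog_ge
  set ℓ := log (log (n : ℝ))
  set L := log (n : ℝ)
  have hℓ0 : 0 < ℓ := by linarith
  have hh := H.h_pos
  have hℓ2 : ℓ ≤ ℓ ^ 2 := by nlinarith
  have ht2 : t ^ 2 + 2 * t + 2 ≤ 2 * t ^ 2 + 3 := by nlinarith [sq_nonneg (t - 1)]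
  have ht20 : 0 ≤ t ^ 2 + 2 * t + 2 := by nlinarith [sq_nonneg (t + 1)]
  rw [sq_abs]
  generalize t ^ 2 + 2 * t + 2 = T at ht2 ht20 ⊢
  calc 2 / √π * exp (-t) * ((√(2 * n) / hscale n) ^ (-(1 / 2) : ℝ) * halfMoment
        + (6 * (36 * ℓ / L) + 2 * (1 / L) + 13 / scale n) * (√π / 2)
        + 2 * (13 / scale n) * T * (√π / 2)
        + 2 * (13 / scale n) * fourthMoment)
      ≤ 2 * exp (-t) * (1 / L * halfMoment
        + (6 * (36 * ℓ / L) + 2 * (1 / L) + 52 / L) * 1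
        + 2 * (52 / L) * (2 * t ^ 2 + 3) * 1 + 2 * (52 / L) * fourthMoment) := by
        gcongr
        exact h.rpow_le
    _ = 2 * (exp (-t) * (halfMoment + 216 * ℓ + 366 + 208 * t ^ 2 + 104 * fourthMoment) / L) := by
        field_simp; ring
    -- Since `ℓ ≥ 1`, both `ℓ` and 1 are at most `ℓ^2`; the constant is `582 = 216 + 366`.
    _ ≤ 2 * (exp (-t) * ((halfMoment + 582 + 104 * fourthMoment) * (ℓ ^ 2 + t ^ 2)) / L) := by
        gcongr
        have e1 : 1 ≤ ℓ ^ 2 := by linarith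
        nlinarith [mul_le_mul_of_nonneg_left e1 hm, mul_le_mul_of_nonneg_left e1 hm4,
          mul_nonneg hm (sq_nonneg t), mul_nonneg hm4 (sq_nonneg t), sq_nonneg t]
    _ = _ := by ring

lemma hsNorm_estimate (h : LargeDim n) {t : ℝ} {g : ℂ → ℝ} (ht : |t| ≤ √(log n) / 10)
    (hg : ∀ z, 0 ≤ g z ∧ g z ≤ 1) (hsupp : Function.support g ⊆ region n t) :
    hsNorm (sandwich g (matrixKernel n))
      ≤ ENNReal.ofReal (√(288 * (halfMoment ^ 2 + 4)) * exp (-√(log n) / 32)) := by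
  have H := h.edgeRegime
  have hL1 := h.log_large
  have hL : 0 < log (n : ℝ) := by linarith
  have hγ := H.γ_pos
  have hn := H.n_pos'
  have hh := H.h_pos
  have hc := h.normRatio_bounds.2
  have he : 36 * log (log n) / log n ≤ 1 := by rw [div_le_one hL]; exact h.loglog_le
  refine (hsNorm_sandwich_le H (by linarith) (h.half_scale_le ht) hg hsupp).trans ?_
  rw [ENNReal.ofReal_rpow_of_nonneg (by positivity) (by norm_num), ← sqrt_eq_rpow]
  refine ENNReal.ofReal_le_ofReal ?_
  set L := log (n : ℝ) with hLdef
  -- In fourth powers `h/√n` becomes at most `L/n = L exp (-L)`; half of this decay absorbs `L^5`,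
  -- and the other half beats multiples of `√L` because `√L ≥ 10`.
  have hkey : scale n * exp (-t) ^ 2 * (hscale n / √n) ≤ exp (-√L / 32) ^ 2 := by
    refine le_of_pow_le_pow_left₀ (n := 4) (by norm_num) (by positivity) ?_
    have h1 : exp (-t) ≤ exp (√L / 10) := exp_le_exp.2 (by linarith [neg_abs_le t])
    have hs : 10 ≤ √L := by
      rw [show (10 : ℝ) = √(10 ^ 2) from (sqrt_sq (by norm_num)).symm]
      exact sqrt_le_sqrt (by linarith)
    have hss : √L ^ 2 = L := sq_sqrt hL.le
    have h5 : L ^ 5 ≤ exp (L / 2) := by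
      refine le_of_sq_le_sq ?_ (exp_pos _).le
      rw [← pow_mul, ← exp_nat_mul]
      have : ((2 : ℕ) : ℝ) * (L / 2) = L := by push_cast; ring
      rw [this, hLdef, exp_log hn]
      exact h.pow_le
    have hsc : scale n ≤ L := by linarith [h.scale_le]
    calc (scale n * exp (-t) ^ 2 * (hscale n / √n)) ^ 4
        = scale n ^ 4 * exp (-t) ^ 8 * (hscale n / √n) ^ 4 := by ring
      _ ≤ L ^ 4 * exp (√L / 10) ^ 8 * (L / n) := by
          gcongr
          exact h.div_pow_le
      _ = L ^ 5 * exp (√L / 10) ^ 8 * exp (-L) := by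
          rw [exp_neg, hLdef, exp_log hn]; ring
      _ ≤ exp (L / 2) * exp (√L / 10) ^ 8 * exp (-L) := by gcongr
      _ = exp (L / 2 + 8 * (√L / 10) + -L) := by
          rw [exp_add, exp_add, ← exp_nat_mul]; norm_num
      _ ≤ exp (8 * (-√L / 32)) := exp_le_exp.2 (by nlinarith)
      _ = (exp (-√L / 32) ^ 2) ^ 4 := by
          rw [← pow_mul, ← exp_nat_mul]; norm_num
  calc √(288 * scale n * exp (-t) ^ 2 * ((halfMoment ^ 2 + 4) * (hscale n / √n)))
      = √(288 * (halfMoment ^ 2 + 4) * (scale n * exp (-t) ^ 2 * (hscale n / √n))) := by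
        congr 1; ring
    _ ≤ √(288 * (halfMoment ^ 2 + 4) * exp (-√L / 32) ^ 2) := by gcongr
    _ = _ := by rw [sqrt_mul (by positivity), sqrt_sq (exp_pos _).le]

lemma edgeEstimate (h : LargeDim n) : EdgeEstimate n
    (2 * (halfMoment + 582 + 104 * fourthMoment) + √(288 * (halfMoment ^ 2 + 4))) := by
  intro t g _ ht hgm hg hsupp
  obtain ⟨C, _, hC⟩ := exists_fixed_bounds h.n_pos
  have hm := halfMoment_nonneg
  have hm4 := fourthMoment_nonneg
  have hL : 0 < log (n : ℝ) := by linarith [h.log_large]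
  refine ⟨(hC g hgm hg).1, (h.trace_estimate ht hgm hg hsupp).trans ?_,
    (h.hsNorm_estimate ht hg hsupp).trans (ENNReal.ofReal_le_ofReal ?_)⟩
  · gcongr
    exact le_add_of_nonneg_right (sqrt_nonneg _)
  · gcongr
    exact le_add_of_nonneg_left (by positivity)

end LargeDim

lemma exists_uniform_edgeEstimate : ∃ C : ℝ, 0 < C ∧ ∀ n, EdgeEstimate n C := by
  obtain ⟨N, hN⟩ := eventually_atTop.1 eventually_largeDim
  choose c hc0 hc using exists_edgeEstimate
  set C₀ := 2 * (halfMoment + 582 + 104 * fourthMoment) + √(288 * (halfMoment ^ 2 + 4)) with hC₀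
  have hm := halfMoment_nonneg
  have hm4 := fourthMoment_nonneg
  have hC₀0 : 0 < C₀ := by positivity
  have hsum : 0 ≤ ∑ k ∈ Finset.range N, c k := Finset.sum_nonneg fun k _ => (hc0 k).le
  -- The sum of the finitely many exceptional constants serves as an upper bound for each of them.
  refine ⟨C₀ + ∑ k ∈ Finset.range N, c k, by linarith, fun n => ?_⟩
  rcases lt_or_ge n N with hn | hn
  · refine (hc n).mono ?_
    have := Finset.single_le_sum (f := c) (fun k _ => (hc0 k).le) (Finset.mem_range.2 hn)
    linarith
  · exact (hN n hn).edgeEstimate.mono (by linarith)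

end Ginibre

end

theorem mainTheorem5 :
    ∃ C : ℝ, 0 < C ∧ ∀ (n : ℕ) (t : ℝ) (g : ℂ → ℝ),
      0 < Ginibre.scale n →
      |t| ≤ √(Real.log n) / 10 →
      Measurable g →
      (∀ z, 0 ≤ g z ∧ g z ≤ 1) →
      Function.support g ⊆ Ginibre.region n t →
      (∀ z, g z = g (conj z)) →
      IntegrableOn
          (fun z => (Ginibre.sandwich g (Ginibre.matrixKernel n) z z).trace) Ginibre.upper ∧
        ‖Ginibre.opTrace (Ginibre.sandwich g (Ginibre.matrixKernel n))
            - ((2 * ∫ x in Set.Ioi t, ∫ y in Set.Ioi (0 : ℝ),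
                g (Ginibre.point n x y) * (Real.exp (-x - y ^ 2) / √Real.pi) : ℝ) : ℂ)‖
          ≤ C * (Real.exp (-t) * ((Real.log (Real.log n)) ^ 2 + |t| ^ 2) / Real.log n) ∧
        Ginibre.hsNorm (Ginibre.sandwich g (Ginibre.matrixKernel n))
          ≤ ENNReal.ofReal (C * Real.exp (-√(Real.log n) / 32)) := by
  obtain ⟨C, hC, h⟩ := Ginibre.exists_uniform_edgeEstimate
  refine ⟨C, hC, fun n t g hγ ht hgm hg hsupp _ => ?_⟩
  obtain ⟨h1, h2, h3⟩ := h n t g hγ ht hgm hg hsupp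
  refine ⟨h1, ?_, h3⟩
  rw [Ginibre.opTrace_sandwich (fun z => (hg z).1), ← Complex.ofReal_sub, Complex.norm_real,
    Real.norm_eq_abs]
  exact h2
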